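/- Let $d\ge 2$, $\omega=e^{2\pi i/d}$, and let $X=\sum_{j=0}^{d-1}|j+1 \bmod d\rangle\langle j|$ and $Z=\sum_{j=0}^{d-1}\omega^j|j\rangle\langle j|$ be the generalized Pauli matrices on $\mathbb C^d$. Let $G'_n$ be the set of operators $\bigotimes_{r=1}^n X^{a_r}Z^{b_r}$ on $(\mathbb C^d)^{\otimes n}$ with $0\le a_r,b_r\le d-1$ and, for each $r$, $a_r=0$ or $b_r=0$. For $g=\bigotimes_{r} X^{a_r}Z^{b_r}$ and $T\subset\{1,\dots,n\}$ write $g^{(T)}=\bigotimes_{r\in T}X^{a_r}Z^{b_r}$. A partition (of $\{1,\dots,n\}$, or of a subset) always means a partition into proper subsets. Commuting operators $g_1,\dots,g_k$ of this form are called separable with respect to a partition $\{T_1,\dots,T_m\}$ if $g_j^{(T_\alpha)}$ and $g_l^{(T_\alpha)}$ commute for all $j,l,\alpha$; inseparable if they are separable with respect to no partition; and complete if the space of vectors fixed by all of them has dimension $1$. Let $g_1,\dots,g_k\in G'_n$ commute pairwise, and suppose that (1) for all $i\ne j$ in $\{1,\dots,n\}$ there is a partition, with respect to which $g_1,\dots,g_k$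 are separable, that has $i$ and $j$ in different blocks; (2) there is a partition $\{T_1,\dots,T_m\}$ with $|T_1|>1$, with respect to which $g_1,\dots,g_k$ are separable, such that $g_1^{(T_1)},\dots,g_k^{(T_1)}$ are inseparable and complete on the qudits of $T_1$. Suppose that the subspace of vectors fixed by $g_1,\dots,g_k$ has dimension $b\ge 1$. Then $b$ divides $d^n$; there are exactly $d^n/b$ distinct nonzero joint eigenspaces $\{v: g_jv=\lambda_jv,\ j=1,\dots,k\}$, $(\lambda_1,\dots,\lambda_k)\in\mathbb C^k$; they are pairwise orthogonal, each has dimension $b$, and together they span $(\mathbb C^d)^{\otimes n}$; and the normalized orthogonal projector onto each of them is an unlockable bound entangled state of the $n$ qudits. Here a state is entangled if it is not a finite convex combination of products of $n$ single-qudit states. If the qudits are divided into groups, each of which may act jointly on its qudits, pure entanglement can be distilled from $\rho$ between two groups $A\neq B$ if for every $\varepsilon>0$ some finite-round LOCC protocol between the groups, acting on $\rho^{\otimes N}$ for some $N$, gives a two-qubit state of $A$ and $B$ with fidelity at least $1-\varepsilon$ with the Bell state $(|00\rangle+|11\rangle)/\sqrt2$. An entangled state is bound entangled if no pure entanglement can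 be distilled between any two of the $n$ parties when each party is a group of its own; it is unlockable if, for some division of the parties into groups, pure entanglement can be distilled between some two groups. -/

import Mathlib

open scoped BigOperators ComplexOrder

noncomputable section

namespace UnlockableBE

/-! ### Generalized Pauli operators -/

/-- The shift matrix `X = ∑ⱼ |j ⊕ 1⟩⟨j|` on a `d`-dimensional space. -/
def shiftX (d : ℕ) : Matrix (Fin d) (Fin d) ℂ :=
  fun r c => if (r : ℕ) = ((c : ℕ) + 1) % d then 1 else 0

/-- The clock matrix `Z = ∑ⱼ ωʲ |j⟩⟨j|`, with `ω = exp (2πi/d)`. -/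
def clockZ (d : ℕ) : Matrix (Fin d) (Fin d) ℂ :=
  Matrix.diagonal fun j => Complex.exp (2 * Real.pi * Complex.I / d) ^ (j : ℕ)

/-- An element `⨂ᵢ X^(a i) Z^(b i)` (with `a i = 0` or `b i = 0` for every qudit `i`) of the set
`G'` on the qudits labelled by `ι`, given by its exponents, which the operator determines. -/
structure PauliElt (ι : Type) (d : ℕ) where
  a : ι → Fin d
  b : ι → Fin d
  pure_type : ∀ i, (a i : ℕ) = 0 ∨ (b i : ℕ) = 0

namespace PauliElt

variable {ι : Type} {d : ℕ}

/-- The operator `⨂ᵢ X^(a i) Z^(b i)`; basis vectors of the multi-qudit space are labelled by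
functions `ι → Fin d`. -/
def op [Fintype ι] (g : PauliElt ι d) : Matrix (ι → Fin d) (ι → Fin d) ℂ :=
  fun x y => ∏ i, (shiftX d ^ (g.a i : ℕ) * clockZ d ^ (g.b i : ℕ)) (x i) (y i)

/-- The restriction of `g` to the qudits in `T`. -/
def restrict (g : PauliElt ι d) (T : Finset ι) : PauliElt {i // i ∈ T} d where
  a i := g.a i
  b i := g.b i
  pure_type i := g.pure_type i

end PauliElt

/-! ### Stabilizers -/

section Stabilizer

variable {ι κ : Type} [Fintype ι] [DecidableEq ι] {d : ℕ}

/-- A partition in which every block is a proper subset. -/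
def IsProperPartition (π : Finpartition (Finset.univ : Finset ι)) : Prop :=
  Finset.univ ∉ π.parts

/-- Separability of the stabilizer generated by the `g j` with respect to a partition: the
generators commute locally, that is, on every block. -/
def StabSeparable (g : κ → PauliElt ι d) (π : Finpartition (Finset.univ : Finset ι)) : Prop :=
  ∀ T ∈ π.parts, ∀ j l, Commute ((g j).restrict T).op ((g l).restrict T).op

/-- Inseparability: not separable with respect to any partition into proper subsets. -/
def StabInseparable (g : κ → PauliElt ι d) : Prop :=
  ∀ π : Finpartition (Finset.univ : Finset ι), IsProperPartition π → ¬ StabSeparable g π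

/-- The joint eigenspace `{v | g j v = μ j • v for all j}`. -/
def jointEigenspace (g : κ → PauliElt ι d) (μ : κ → ℂ) :
    Submodule ℂ (EuclideanSpace ℂ (ι → Fin d)) :=
  ⨅ j, Module.End.eigenspace (Matrix.toEuclideanLin (g j).op) (μ j)

/-- The subspace stabilized by all `g j`. -/
def stabilizedSubspace (g : κ → PauliElt ι d) : Submodule ℂ (EuclideanSpace ℂ (ι → Fin d)) :=
  jointEigenspace g fun _ => 1

/-- A complete stabilizer: the stabilized subspace is one-dimensional. -/
def StabComplete (g : κ → PauliElt ι d) : Prop :=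
  Module.finrank ℂ (stabilizedSubspace g) = 1

/-- The nonzero joint eigenspaces of the `g j`. -/
def jointEigenspaces (g : κ → PauliElt ι d) :
    Set (Submodule ℂ (EuclideanSpace ℂ (ι → Fin d))) :=
  {E | E ≠ ⊥ ∧ ∃ μ : κ → ℂ, E = jointEigenspace g μ}

end Stabilizer

/-! ### States -/

/-- Density operators. -/
def IsDensity {α : Type} [Fintype α] (ρ : Matrix α α ℂ) : Prop :=
  ρ.PosSemidef ∧ ρ.trace = 1

/-- The matrix of the orthogonal projector onto `E` in the standard basis. -/
def projMatrix {α : Type} [Fintype α] [DecidableEq α]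
    (E : Submodule ℂ (EuclideanSpace ℂ α)) : Matrix α α ℂ :=
  fun x y => E.starProjection (EuclideanSpace.single y 1) x

/-- The normalized projector `P / tr P` onto `E`, the maximally mixed state over `E`. -/
def maxMixed {α : Type} [Fintype α] [DecidableEq α]
    (E : Submodule ℂ (EuclideanSpace ℂ α)) : Matrix α α ℂ :=
  (projMatrix E).trace⁻¹ • projMatrix E

section States

variable {ι : Type} [Fintype ι] [DecidableEq ι] {d : ℕ}

/-- Separability of a multi-qudit state with respect to a partition: a finite convex combination
of tensor products of density operators of the blocks. -/
def SeparableState (ρ : Matrix (ι → Fin d) (ι → Fin d) ℂ)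
    (π : Finpartition (Finset.univ : Finset ι)) : Prop :=
  ∃ (m : ℕ) (p : Fin m → ℝ)
    (σ : Fin m → ∀ T : {T // T ∈ π.parts},
      Matrix ({i // i ∈ T.1} → Fin d) ({i // i ∈ T.1} → Fin d) ℂ),
    (∀ s, 0 < p s) ∧ ∑ s, p s = 1 ∧ (∀ s T, IsDensity (σ s T)) ∧
    ∀ x y, ρ x y = ∑ s, (p s : ℂ) * ∏ T, σ s T (fun i => x i) (fun i => y i)

end States

/-! ### Local operations and classical communication -/

/-- A quantum measurement with finitely many outcomes, given by Kraus operators. -/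
structure Instrument (A B : Type) [Fintype A] [DecidableEq A] [Fintype B] where
  m : ℕ
  K : Fin m → Matrix B A ℂ
  complete : ∑ s, (K s).conjTranspose * K s = 1

/-- Finite-round LOCC protocols for the parties `P`, from local systems with bases `H p` to local
systems with bases `out p`. In each round every party performs a local measurement (possibly a
trivial one, and possibly changing its local system), then all outcomes are broadcast, and the
rest of the protocol may depend on them. -/
inductive LOCC {P : Type} (out : P → Type)
    [∀ p, Fintype (out p)] [∀ p, DecidableEq (out p)] :
    (H : P → Type) → [∀ p, Fintype (H p)] → [∀ p, DecidableEq (H p)] → Type 1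
  | done : LOCC out out
  | round {H : P → Type} [∀ p, Fintype (H p)] [∀ p, DecidableEq (H p)]
      {H' : P → Type} [∀ p, Fintype (H' p)] [∀ p, DecidableEq (H' p)]
      (M : ∀ p, Instrument (H p) (H' p))
      (next : (∀ p, Fin (M p).m) → LOCC out H') : LOCC out H

/-- The tensor product of local operators. -/
def tensorOp {P : Type} [Fintype P] {H H' : P → Type} (A : ∀ p, Matrix (H' p) (H p) ℂ) :
    Matrix (∀ p, H' p) (∀ p, H p) ℂ :=
  fun x y => ∏ p, A p (x p) (y p)

/-- The final state of a protocol, averaged over all measurement outcomes. -/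
def LOCC.run {P : Type} [Fintype P] [DecidableEq P] {out : P → Type}
    [∀ p, Fintype (out p)] [∀ p, DecidableEq (out p)] :
    {H : P → Type} → [∀ p, Fintype (H p)] → [∀ p, DecidableEq (H p)] →
    LOCC out H → Matrix (∀ p, H p) (∀ p, H p) ℂ → Matrix (∀ p, out p) (∀ p, out p) ℂ
  | _, _, _, @LOCC.done _ _ _ _, ρ => ρ
  | _, _, _, @LOCC.round _ _ _ _ _ _ _ _ _ _ M next, ρ =>
      ∑ s : ∀ p, Fin (M p).m, (next s).run
        (tensorOp (fun p => (M p).K (s p)) * ρ *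
          (tensorOp fun p => (M p).K (s p)).conjTranspose)

section Distillation

variable {ι : Type} [Fintype ι] [DecidableEq ι] {d : ℕ}

/-- The local system of a block `T` holding its qudits from `N` copies: basis labels. -/
abbrev BlockSystem (d N : ℕ) {π : Finpartition (Finset.univ : Finset ι)}
    (T : {T // T ∈ π.parts}) : Type :=
  Fin N → {i // i ∈ T.1} → Fin d

/-- `N` copies of `ρ`, as a state shared by the blocks of `π`. -/
def copies (ρ : Matrix (ι → Fin d) (ι → Fin d) ℂ)
    (π : Finpartition (Finset.univ : Finset ι)) (N : ℕ) :
    Matrix (∀ T : {T // T ∈ π.parts}, BlockSystem d N T)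
      (∀ T : {T // T ∈ π.parts}, BlockSystem d N T) ℂ :=
  fun x y => ∏ t : Fin N,
    ρ (fun i => x ⟨π.part i, π.part_mem.2 (Finset.mem_univ i)⟩ t
          ⟨i, π.mem_part (Finset.mem_univ i)⟩)
      (fun i => y ⟨π.part i, π.part_mem.2 (Finset.mem_univ i)⟩ t
          ⟨i, π.mem_part (Finset.mem_univ i)⟩)

/-- The reduced state of the parties `A ≠ B` when every party holds one qubit. -/
def pairState {P : Type} [Fintype P] [DecidableEq P]
    (σ : Matrix (P → Fin 2) (P → Fin 2) ℂ) (A B : P) :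
    Matrix (Fin 2 × Fin 2) (Fin 2 × Fin 2) ℂ :=
  fun s t => ∑ z : P → Fin 2 with z A = 0 ∧ z B = 0,
    σ (Function.update (Function.update z A s.1) B s.2)
      (Function.update (Function.update z A t.1) B t.2)

/-- The fidelity `⟨Φ|τ|Φ⟩` with the Bell state `Φ = (|00⟩ + |11⟩)/√2`. -/
def bellFidelity (τ : Matrix (Fin 2 × Fin 2) (Fin 2 × Fin 2) ℂ) : ℝ :=
  (∑ r : Fin 2, ∑ c : Fin 2, τ (r, r) (c, c)).re / 2

/-- Pure entanglement can be distilled from `ρ` between the blocks `A` and `B` when the qudits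
inside each block of `π` are joined together and distinct blocks remain separated: from
sufficiently many copies of `ρ`, LOCC between the blocks yields a two-qubit state of `A` and `B`
arbitrarily close to a Bell state. -/
def Distillable (ρ : Matrix (ι → Fin d) (ι → Fin d) ℂ)
    (π : Finpartition (Finset.univ : Finset ι)) (A B : {T // T ∈ π.parts}) : Prop :=
  ∀ ε : ℝ, 0 < ε → ∃ (N : ℕ)
    (Λ : LOCC (fun _ : {T // T ∈ π.parts} => Fin 2) fun T => BlockSystem d N T),
    1 - ε ≤ bellFidelity (pairState (Λ.run (copies ρ π N)) A B)

/-- An entangled state is bound entangled if no pure entanglement can be distilled between any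
two parties while all parties remain separated. -/
def IsBoundEntangled (ρ : Matrix (ι → Fin d) (ι → Fin d) ℂ) : Prop :=
  IsDensity ρ ∧ ¬ SeparableState ρ ⊥ ∧
  ∀ A B : {T // T ∈ (⊥ : Finpartition (Finset.univ : Finset ι)).parts},
    A ≠ B → ¬ Distillable ρ ⊥ A B

/-- A bound entangled state is unlockable if, after the parties are divided into suitable groups
each of which joins together, pure entanglement can be distilled between some two groups. -/
def IsUnlockableBoundEntangled (ρ : Matrix (ι → Fin d) (ι → Fin d) ℂ) : Prop :=
  IsBoundEntangled ρ ∧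
  ∃ (π : Finpartition (Finset.univ : Finset ι)) (A B : {T // T ∈ π.parts}),
    A ≠ B ∧ Distillable ρ π A B

end Distillation

end UnlockableBE

end

noncomputable section

set_option linter.unusedSectionVars false

namespace UnlockableBE

/-! ### Tensor products of local operators and the partial transpose -/

section Tensor

variable {P : Type} [Fintype P] [DecidableEq P] {H H' H'' : P → Type}

/-! Two Pauli strings commute up to a scalar that is a product of one phase per qudit (`phase`).
Commuting on a block `T` therefore means that the phases over `T` multiply to 1
(`commute_restrict_iff`), and the argument rests on these phases.

Counting. Every Pauli string `W`, with no restriction on its exponents, satisfies `g j * W = q j •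
(W * g j)`, so it carries each joint eigenspace onto another one of the same dimension. The strings
span all matrices, so their images of one nonzero vector span the whole space. Hence the nonzero
joint eigenspaces have equal dimension (`finrank_eq_of_ne_bot`) and span (`sSup_jointEigenspaces`).
They are orthogonal because the generators are unitary, and the count is a quotient of dimensions.

No distillation between separated parties. The projector `P` onto a joint eigenspace lies in the
algebra generated by the `g j`. If the phases over a set `S` multiply to 1 for every pair of
generators, partial transposition on `S` is multiplicative on this algebra, so it sends `P` to a
projection (`partialTranspose_posSemidef`). Condition (1) provides such an `S` separating any two
qudits. Positivity of the partial transpose survives taking copies and LOCC, and it bounds the Bell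
fidelity by 1/2 (`not_distillable_of_posSemidef`).

Entanglement. Inseparability on `T₁` yields a qudit `i` and two generators whose phase at `i` is not
1. Each product term of a separable decomposition would be a common eigenoperator of both
generators, and so would its factor at `i`, which the phase forbids (`not_separableState`).

Unlocking. Join all qudits other than `i`. The two generators become `V A ⊗ V B` and `U A ⊗ U B`,
where `V A` and `U A` commute up to a phase `τ ≠ 1`. Eigenvalues of `V A` and `V B` are perfectly
correlated, and `U A ⊗ U B` links the sectors `c` and `τ * c` coherently. Those two sectors serve as
the levels of a qubit, and a single copy gives an exact Bell state (`exists_bell_protocol`). -/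

theorem tensorOp_mul [∀ p, Fintype (H' p)] (A : ∀ p, Matrix (H'' p) (H' p) ℂ)
    (B : ∀ p, Matrix (H' p) (H p) ℂ) :
    tensorOp A * tensorOp B = tensorOp fun p => A p * B p := by
  ext x y
  simp [tensorOp, Matrix.mul_apply, Finset.prod_univ_sum, Fintype.piFinset_univ,
    Finset.prod_mul_distrib]

theorem tensorOp_one [∀ p, DecidableEq (H p)] :
    tensorOp (fun p => (1 : Matrix (H p) (H p) ℂ)) = 1 := by
  ext x y
  simp [tensorOp, Matrix.one_apply, Finset.prod_ite_zero, funext_iff]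

theorem tensorOp_smul (c : P → ℂ) (A : ∀ p, Matrix (H' p) (H p) ℂ) :
    tensorOp (fun p => c p • A p) = (∏ p, c p) • tensorOp A := by
  ext x y
  simp [tensorOp, Finset.prod_mul_distrib]

theorem tensorOp_conjTranspose (A : ∀ p, Matrix (H' p) (H p) ℂ) :
    (tensorOp A).conjTranspose = tensorOp fun p => (A p).conjTranspose := by
  ext x y
  simp [tensorOp, Matrix.conjTranspose_apply]

theorem tensorOp_pow [∀ p, Fintype (H p)] [∀ p, DecidableEq (H p)]
    (A : ∀ p, Matrix (H p) (H p) ℂ) (m : ℕ) :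
    tensorOp A ^ m = tensorOp fun p => A p ^ m := by
  induction m with
  | zero => simp [tensorOp_one]
  | succ m ih => simp [pow_succ, ih, tensorOp_mul]

theorem sum_tensorOp {σ : P → Type} [∀ p, Fintype (σ p)]
    (A : ∀ p, σ p → Matrix (H' p) (H p) ℂ) :
    ∑ s : ∀ p, σ p, tensorOp (fun p => A p (s p)) = tensorOp fun p => ∑ s, A p s := by
  ext x y
  simp [tensorOp, Matrix.sum_apply, Finset.prod_univ_sum, Fintype.piFinset_univ]

open scoped MatrixOrder in
theorem tensorOp_posSemidef [∀ p, Fintype (H p)] [∀ p, DecidableEq (H p)]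
    {A : ∀ p, Matrix (H p) (H p) ℂ} (hA : ∀ p, (A p).PosSemidef) : (tensorOp A).PosSemidef := by
  choose B hB using fun p => CStarAlgebra.nonneg_iff_eq_star_mul_self.mp (hA p).nonneg
  have : tensorOp A = (tensorOp B).conjTranspose * tensorOp B := by
    rw [tensorOp_conjTranspose, tensorOp_mul]
    congr 1
    exact funext hB
  rw [this]
  exact Matrix.posSemidef_conjTranspose_mul_self _

/-- The configuration that agrees with `y` on `S` and with `x` elsewhere. -/
def mix (S : P → Prop) [DecidablePred S] (x y : ∀ p, H p) : ∀ p, H p :=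
  fun p => if S p then y p else x p

/-- The partial transpose of a multipartite operator on the parties in `S`. -/
def partialTranspose (S : P → Prop) [DecidablePred S] (M : Matrix (∀ p, H p) (∀ p, H p) ℂ) :
    Matrix (∀ p, H p) (∀ p, H p) ℂ :=
  fun x y => M (mix S x y) (mix S y x)

variable (S : P → Prop) [DecidablePred S]

theorem mix_mix (x y : ∀ p, H p) : mix S (mix S x y) (mix S y x) = x := by
  funext p
  by_cases h : S p <;> simp [mix, h]

/-- Exchanging the `S`-components of two configurations. -/
def mixEquiv : (∀ p, H p) × (∀ p, H p) ≃ (∀ p, H p) × (∀ p, H p) where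
  toFun z := (mix S z.1 z.2, mix S z.2 z.1)
  invFun z := (mix S z.1 z.2, mix S z.2 z.1)
  left_inv z := by simp [mix_mix]
  right_inv z := by simp [mix_mix]

theorem partialTranspose_conjTranspose (M : Matrix (∀ p, H p) (∀ p, H p) ℂ) :
    (partialTranspose S M).conjTranspose = partialTranspose S M.conjTranspose := rfl

theorem partialTranspose_add (M N : Matrix (∀ p, H p) (∀ p, H p) ℂ) :
    partialTranspose S (M + N) = partialTranspose S M + partialTranspose S N := rfl

theorem partialTranspose_smul (c : ℂ) (M : Matrix (∀ p, H p) (∀ p, H p) ℂ) :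
    partialTranspose S (c • M) = c • partialTranspose S M := rfl

theorem partialTranspose_sum {τ : Type} (s : Finset τ) (M : τ → Matrix (∀ p, H p) (∀ p, H p) ℂ) :
    partialTranspose S (∑ t ∈ s, M t) = ∑ t ∈ s, partialTranspose S (M t) := by
  ext x y
  simp [partialTranspose, Matrix.sum_apply]

theorem partialTranspose_tensorOp (A : ∀ p, Matrix (H p) (H p) ℂ) :
    partialTranspose S (tensorOp A) = tensorOp fun p => if S p then (A p).transpose else A p := by
  ext x y
  refine Finset.prod_congr rfl fun p _ => ?_
  by_cases h : S p <;> simp [mix, h]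

/-- A product operator can be exchanged with partial transposition at the cost of conjugating its
factors on `S`: there the row and column entries trade places, and one of them carries a `star`.
This is what lets local Kraus operators preserve positivity of the partial transpose. -/
theorem partialTranspose_conj [∀ p, Fintype (H p)] (A : ∀ p, Matrix (H' p) (H p) ℂ)
    (M : Matrix (∀ p, H p) (∀ p, H p) ℂ) :
    partialTranspose S (tensorOp A * M * (tensorOp A).conjTranspose) =
      tensorOp (fun p => if S p then (A p).map star else A p) * partialTranspose S M *
        (tensorOp fun p => if S p then (A p).map star else A p).conjTranspose := by
  ext x y
  have expand : ∀ (B : Matrix (∀ p, H' p) (∀ p, H p) ℂ) (N : Matrix (∀ p, H p) (∀ p, H p) ℂ)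
      (x y : ∀ p, H' p), (B * N * B.conjTranspose) x y =
        ∑ z : (∀ p, H p) × (∀ p, H p), B x z.1 * star (B y z.2) * N z.1 z.2 := by
    intro B N x y
    simp only [Matrix.mul_apply, Finset.sum_mul, Matrix.conjTranspose_apply]
    rw [Finset.sum_comm, Fintype.sum_prod_type]
    exact Finset.sum_congr rfl fun _ _ => Finset.sum_congr rfl fun _ _ => by ring
  rw [expand]
  change (tensorOp A * M * (tensorOp A).conjTranspose) (mix S x y) (mix S y x) = _
  rw [expand]
  refine Fintype.sum_equiv (mixEquiv S) _ _ fun z => ?_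
  have h1 := mix_mix S z.1 z.2
  have h2 := mix_mix S z.2 z.1
  simp only [mixEquiv, Equiv.coe_fn_mk, partialTranspose, h1, h2]
  congr 1
  simp only [tensorOp, star_prod]
  rw [← Finset.prod_mul_distrib, ← Finset.prod_mul_distrib]
  refine Finset.prod_congr rfl fun p _ => ?_
  by_cases h : S p <;> simp [mix, h, mul_comm]

end Tensor

/-! ### Generalized Pauli operators -/

section Weyl

variable (d : ℕ)

/-- The primitive root of unity `exp (2πi/d)`. -/
def omega : ℂ := Complex.exp (2 * Real.pi * Complex.I / d)

theorem omega_primitive [NeZero d] : IsPrimitiveRoot (omega d) d :=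
  Complex.isPrimitiveRoot_exp d (NeZero.ne d)

theorem omega_ne_zero : omega d ≠ 0 := Complex.exp_ne_zero _

theorem omega_pow_mod [NeZero d] (m : ℕ) : omega d ^ (m % d) = omega d ^ m :=
  (pow_eq_pow_mod m (omega_primitive d).pow_eq_one).symm

theorem geom_sum_root [NeZero d] {ζ : ℂ} (h : ζ ^ d = 1) :
    ∑ m : Fin d, ζ ^ (m : ℕ) = if ζ = 1 then (d : ℂ) else 0 := by
  rw [Fin.sum_univ_eq_sum_range (fun m => ζ ^ m) d]
  split_ifs with h1
  · simp [h1]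
  · rw [geom_sum_eq h1, h, sub_self, zero_div]

theorem shiftX_pow_apply [NeZero d] (a : ℕ) (r c : Fin d) :
    (shiftX d ^ a) r c = if (r : ℕ) = ((c : ℕ) + a) % d then 1 else 0 := by
  induction a generalizing r with
  | zero => simp [Matrix.one_apply, Nat.mod_eq_of_lt c.2, Fin.ext_iff]
  | succ a ih =>
    rw [pow_succ', Matrix.mul_apply,
      Finset.sum_eq_single (⟨((c : ℕ) + a) % d, Nat.mod_lt _ (NeZero.pos d)⟩ : Fin d)]
    · simp [ih, shiftX, Nat.add_assoc]
    · intro s _ hs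
      rw [ih, if_neg, mul_zero]
      exact fun h => hs (Fin.ext h)
    · simp

theorem clockZ_pow_eq (b : ℕ) :
    clockZ d ^ b = Matrix.diagonal fun j : Fin d => omega d ^ ((j : ℕ) * b) := by
  rw [clockZ, Matrix.diagonal_pow]
  congr 1
  funext j
  rw [Pi.pow_apply, pow_mul]
  rfl

theorem shiftX_pow_dim [NeZero d] : shiftX d ^ d = 1 := by
  ext r c
  simp [shiftX_pow_apply, Matrix.one_apply, Nat.mod_eq_of_lt c.2, Fin.ext_iff]

theorem clockZ_pow_dim [NeZero d] : clockZ d ^ d = 1 := by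
  rw [clockZ_pow_eq]
  simp [mul_comm _ d, pow_mul, (omega_primitive d).pow_eq_one]

theorem shiftX_mem_unitaryGroup [NeZero d] : shiftX d ∈ Matrix.unitaryGroup (Fin d) ℂ := by
  rw [Matrix.mem_unitaryGroup_iff']
  ext r c
  rw [Matrix.mul_apply,
      Finset.sum_eq_single (⟨((c : ℕ) + 1) % d, Nat.mod_lt _ (NeZero.pos d)⟩ : Fin d)]
  · have : ((c : ℕ) + 1) % d = ((r : ℕ) + 1) % d ↔ r = c := by
      constructor
      · intro h
        have := Nat.ModEq.add_right_cancel' 1 (show (c : ℕ) + 1 ≡ r + 1 [MOD d] from h)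
        exact Fin.ext ((this.eq_of_lt_of_lt c.2 r.2).symm)
      · rintro rfl
        rfl
    simp [Matrix.star_apply, shiftX, this, Matrix.one_apply, apply_ite]
  · intro s _ hs
    have : ¬ (s : ℕ) = ((c : ℕ) + 1) % d := fun h => hs (Fin.ext h)
    simp [shiftX, this]
  · simp

theorem norm_omega [NeZero d] : ‖omega d‖ = 1 :=
  Complex.norm_eq_one_of_pow_eq_one (omega_primitive d).pow_eq_one (NeZero.ne d)

theorem clockZ_mem_unitaryGroup [NeZero d] : clockZ d ∈ Matrix.unitaryGroup (Fin d) ℂ := by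
  rw [Matrix.mem_unitaryGroup_iff', ← pow_one (clockZ d), clockZ_pow_eq,
    Matrix.star_eq_conjTranspose, Matrix.diagonal_conjTranspose, Matrix.diagonal_mul_diagonal,
    ← Matrix.diagonal_one]
  congr 1
  funext j
  have : star (omega d) * omega d = 1 := by
    rw [Complex.star_def, mul_comm, Complex.mul_conj, Complex.normSq_eq_norm_sq, norm_omega]
    simp
  simp only [Pi.star_apply, star_pow, mul_one]
  rw [← mul_pow, this, one_pow]

/-- The operator `X ^ a * Z ^ b`. -/
def weyl (a b : ℕ) : Matrix (Fin d) (Fin d) ℂ := shiftX d ^ a * clockZ d ^ b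

theorem weyl_apply [NeZero d] (a b : ℕ) (r c : Fin d) :
    weyl d a b r c = if (r : ℕ) = ((c : ℕ) + a) % d then omega d ^ ((c : ℕ) * b) else 0 := by
  rw [weyl, clockZ_pow_eq, Matrix.mul_diagonal, shiftX_pow_apply]
  split_ifs <;> simp

theorem weyl_mem_unitaryGroup [NeZero d] (a b : ℕ) :
    weyl d a b ∈ Matrix.unitaryGroup (Fin d) ℂ :=
  mul_mem (pow_mem (shiftX_mem_unitaryGroup d) a) (pow_mem (clockZ_mem_unitaryGroup d) b)

theorem clockZ_pow_mul_shiftX_pow [NeZero d] (a b : ℕ) :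
    clockZ d ^ b * shiftX d ^ a = omega d ^ (b * a) • (shiftX d ^ a * clockZ d ^ b) := by
  ext r c
  have := weyl_apply d a b r c
  rw [weyl] at this
  rw [Matrix.smul_apply, this, clockZ_pow_eq, Matrix.diagonal_mul, shiftX_pow_apply]
  split_ifs with h
  · rw [h, pow_mul, omega_pow_mod, smul_eq_mul, mul_one, ← pow_mul, ← pow_add]
    congr 1
    ring
  · simp

theorem weyl_mul_weyl [NeZero d] (a b a' b' : ℕ) :
    weyl d a b * weyl d a' b' = omega d ^ (b * a') • weyl d (a + a') (b + b') := by
  rw [weyl, weyl, weyl, mul_assoc, ← mul_assoc (clockZ d ^ b), clockZ_pow_mul_shiftX_pow,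
    Matrix.smul_mul, Matrix.mul_smul, pow_add, pow_add, mul_assoc, mul_assoc]

theorem weyl_mul_weyl_comm [NeZero d] (a b a' b' : ℕ) :
    weyl d a b * weyl d a' b' =
      (omega d ^ (b * a') / omega d ^ (b' * a)) • (weyl d a' b' * weyl d a b) := by
  rw [weyl_mul_weyl, weyl_mul_weyl, smul_smul, div_mul_cancel₀ _ (pow_ne_zero _ (omega_ne_zero d)),
    add_comm a, add_comm b]

theorem weyl_pow_dim [NeZero d] {a b : ℕ} (h : a = 0 ∨ b = 0) : weyl d a b ^ d = 1 := by
  rcases h with rfl | rfl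
  · rw [weyl, pow_zero, one_mul, ← pow_mul, mul_comm, pow_mul, clockZ_pow_dim, one_pow]
  · rw [weyl, pow_zero, mul_one, ← pow_mul, mul_comm, pow_mul, shiftX_pow_dim, one_pow]

/-- Discrete Fourier inversion: averaging the powers of `Z` against a character projects onto the
`u`-th basis vector, and a power of `X` then moves it to `v`. The exponent `v + (d - u)` is `v - u`
modulo `d`, free of truncated subtraction. -/
theorem single_eq_sum_weyl [NeZero d] (v u : Fin d) :
    Matrix.single v u (1 : ℂ) =
      ∑ b : Fin d, ((d : ℂ)⁻¹ * (omega d ^ (u : ℕ))⁻¹ ^ (b : ℕ)) • weyl d (v + (d - u)) b := by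
  have hd : (d : ℂ) ≠ 0 := Nat.cast_ne_zero.2 (NeZero.ne d)
  have hw := omega_ne_zero d
  ext r c
  have key : ∑ b : Fin d, (omega d ^ (u : ℕ))⁻¹ ^ (b : ℕ) * omega d ^ ((c : ℕ) * (b : ℕ)) =
      if u = c then (d : ℂ) else 0 := by
    have h1 : ((omega d ^ (u : ℕ))⁻¹ * omega d ^ (c : ℕ)) ^ d = 1 := by
      have hp : ∀ m : ℕ, (omega d ^ m) ^ d = 1 := fun m => by
        rw [← pow_mul, mul_comm, pow_mul, (omega_primitive d).pow_eq_one, one_pow]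
      rw [mul_pow, inv_pow, hp, hp, inv_one, one_mul]
    have h2 : (omega d ^ (u : ℕ))⁻¹ * omega d ^ (c : ℕ) = 1 ↔ u = c := by
      rw [inv_mul_eq_one₀ (pow_ne_zero _ hw)]
      exact ⟨fun h => Fin.ext ((omega_primitive d).pow_inj u.2 c.2 h), fun h => by rw [h]⟩
    have := geom_sum_root d h1
    simp only [h2] at this
    rw [← this]
    exact Finset.sum_congr rfl fun b _ => by rw [mul_pow, pow_mul]
  rw [Matrix.sum_apply]
  simp only [Matrix.smul_apply, weyl_apply, smul_eq_mul, Matrix.single_apply, mul_ite, mul_zero]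
  by_cases hc : u = c
  · subst hc
    have : ((u : ℕ) + (v + (d - u))) % d = v := by
      rw [show (u : ℕ) + (v + (d - u)) = v + d by omega, Nat.add_mod_right, Nat.mod_eq_of_lt v.2]
    simp only [this]
    by_cases hr : v = r
    · subst hr
      simp only [and_self, if_true, mul_assoc, ← Finset.mul_sum, key]
      field_simp
    · have : ¬ (r : ℕ) = v := fun h => hr (Fin.ext h.symm)
      simp [hr, this]
  · simp only [hc, and_false, if_false]
    by_cases hr : (r : ℕ) = ((c : ℕ) + (v + (d - u))) % d
    · simp only [if_pos hr, mul_assoc, ← Finset.mul_sum, key, if_neg hc, mul_zero]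
    · simp [hr]

end Weyl

/-! ### Pauli strings on several qudits: spanning and commutation phases. -/

section MultiQudit

variable {ι : Type} [Fintype ι] [DecidableEq ι] {d : ℕ}

theorem tensorOp_mem_unitaryGroup {H : ι → Type} [∀ p, Fintype (H p)] [∀ p, DecidableEq (H p)]
    {A : ∀ p, Matrix (H p) (H p) ℂ} (hA : ∀ p, A p ∈ Matrix.unitaryGroup (H p) ℂ) :
    tensorOp A ∈ Matrix.unitaryGroup (∀ p, H p) ℂ := by
  rw [Matrix.mem_unitaryGroup_iff', Matrix.star_eq_conjTranspose, tensorOp_conjTranspose,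
    tensorOp_mul, ← tensorOp_one]
  congr 1
  funext p
  exact Matrix.mem_unitaryGroup_iff'.1 (hA p)

/-- The tensor product of the operators `X ^ a i * Z ^ b i`. -/
def multiWeyl (d : ℕ) (e : (ι → ℕ) × (ι → ℕ)) : Matrix (ι → Fin d) (ι → Fin d) ℂ :=
  tensorOp (H := fun _ => Fin d) (H' := fun _ => Fin d) fun i => weyl d (e.1 i) (e.2 i)

theorem span_multiWeyl [NeZero d] :
    Submodule.span ℂ (Set.range (multiWeyl (ι := ι) d)) = ⊤ := by
  rw [eq_top_iff]
  intro M _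
  rw [Matrix.matrix_eq_sum_single M]
  refine Submodule.sum_mem _ fun y _ => Submodule.sum_mem _ fun x _ => ?_
  have h : Matrix.single y x (M y x) = M y x • tensorOp (H := fun _ : ι => Fin d)
      (H' := fun _ => Fin d) fun i => Matrix.single (y i) (x i) (1 : ℂ) := by
    ext r c
    simp [Matrix.single_apply, tensorOp, Finset.prod_ite_zero, funext_iff, forall_and]
  rw [h]
  refine Submodule.smul_mem _ _ ?_
  simp only [single_eq_sum_weyl]
  rw [← sum_tensorOp]
  refine Submodule.sum_mem _ fun b _ => ?_
  rw [tensorOp_smul]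
  exact Submodule.smul_mem _ _ (Submodule.subset_span
    ⟨(fun i => (y i : ℕ) + (d - x i), fun i => (b i : ℕ)), rfl⟩)

/-- The strings span all matrices, and matrices act transitively on nonzero vectors; so no nonzero
vector is confined to a proper subspace invariant under the strings. -/
theorem span_multiWeyl_apply [NeZero d] {v : EuclideanSpace ℂ (ι → Fin d)} (hv : v ≠ 0) :
    Submodule.span ℂ (Set.range fun e => Matrix.toEuclideanLin (multiWeyl (ι := ι) d e) v) = ⊤ := by
  have hr : (Set.range fun e => Matrix.toEuclideanLin (multiWeyl (ι := ι) d e) v) =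
      ((LinearMap.applyₗ v).comp (Matrix.toEuclideanLin (𝕜 := ℂ) (m := ι → Fin d)
        (n := ι → Fin d)).toLinearMap) '' Set.range (multiWeyl (ι := ι) d) := by
    rw [← Set.range_comp]
    rfl
  rw [hr, Submodule.span_image, span_multiWeyl, Submodule.map_top, LinearMap.range_eq_top]
  intro u
  obtain ⟨x, hx⟩ : ∃ x, v x ≠ 0 := by
    by_contra! h
    exact hv (PiLp.ext h)
  -- A matrix whose only nonzero column is at `x`, where `v` does not vanish, sends `v` to any
  -- prescribed `u`.
  refine ⟨Matrix.of fun r c => if c = x then u r / v x else 0, ?_⟩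
  ext r
  simp [Matrix.toLpLin_apply, Matrix.mulVec, dotProduct, hx]

/-- The scalar by which the `i`-th tensor factors of `g` and `h` commute. -/
def phase {ι : Type} {d : ℕ} (g h : PauliElt ι d) (i : ι) : ℂ :=
  omega d ^ ((g.b i : ℕ) * h.a i) / omega d ^ ((h.b i : ℕ) * g.a i)

/-- The `i`-th tensor factor of `g`. -/
def site {ι : Type} {d : ℕ} (g : PauliElt ι d) (i : ι) : Matrix (Fin d) (Fin d) ℂ :=
  weyl d (g.a i) (g.b i)

theorem op_eq_tensorOp (g : PauliElt ι d) :
    g.op = tensorOp (H := fun _ => Fin d) (H' := fun _ => Fin d) (site g) := rfl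

theorem site_mul_site [NeZero d] (g h : PauliElt ι d) (i : ι) :
    site g i * site h i = phase g h i • (site h i * site g i) :=
  weyl_mul_weyl_comm d _ _ _ _

theorem op_mul_op [NeZero d] (g h : PauliElt ι d) :
    g.op * h.op = (∏ i, phase g h i) • (h.op * g.op) := by
  simp only [op_eq_tensorOp, tensorOp_mul, site_mul_site g h, tensorOp_smul]

theorem op_mem_unitaryGroup [NeZero d] (g : PauliElt ι d) :
    g.op ∈ Matrix.unitaryGroup (ι → Fin d) ℂ :=
  tensorOp_mem_unitaryGroup fun _ => weyl_mem_unitaryGroup d _ _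

theorem op_pow_dim [NeZero d] (g : PauliElt ι d) : g.op ^ d = 1 := by
  rw [op_eq_tensorOp, tensorOp_pow, ← tensorOp_one]
  congr 1
  funext i
  exact weyl_pow_dim d (g.pure_type i)

theorem unitary_ne_zero {α : Type} [Fintype α] [DecidableEq α] [Nonempty α] {U : Matrix α α ℂ}
    (hU : U ∈ Matrix.unitaryGroup α ℂ) : U ≠ 0 := by
  rintro rfl
  have := Matrix.mem_unitaryGroup_iff.1 hU
  simp at this

theorem commute_op_iff [NeZero d] (g h : PauliElt ι d) :
    Commute g.op h.op ↔ ∏ i, phase g h i = 1 := by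
  constructor
  · intro hc
    have h1 := op_mul_op g h
    rw [hc.eq] at h1
    have h2 : (1 - ∏ i, phase g h i) • (h.op * g.op) = 0 := by
      rw [sub_smul, one_smul, ← h1, sub_self]
    rcases smul_eq_zero.1 h2 with h3 | h3
    · exact (sub_eq_zero.1 h3).symm
    · exact absurd h3 (unitary_ne_zero (mul_mem (op_mem_unitaryGroup h) (op_mem_unitaryGroup g)))
  · intro h1
    rw [commute_iff_eq, op_mul_op, h1, one_smul]

theorem commute_restrict_iff [NeZero d] (g h : PauliElt ι d) (T : Finset ι) :
    Commute (g.restrict T).op (h.restrict T).op ↔ ∏ i ∈ T, phase g h i = 1 := by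
  rw [commute_op_iff, ← Finset.prod_coe_sort T (phase g h)]
  rfl

theorem multiWeyl_mem_unitaryGroup [NeZero d] (e : (ι → ℕ) × (ι → ℕ)) :
    multiWeyl d e ∈ Matrix.unitaryGroup (ι → Fin d) ℂ :=
  tensorOp_mem_unitaryGroup fun _ => weyl_mem_unitaryGroup d _ _

theorem op_mul_multiWeyl [NeZero d] (g : PauliElt ι d) (e : (ι → ℕ) × (ι → ℕ)) :
    ∃ q : ℂ, q ≠ 0 ∧ g.op * multiWeyl d e = q • (multiWeyl d e * g.op) := by
  refine ⟨∏ i, (omega d ^ ((g.b i : ℕ) * e.1 i) / omega d ^ (e.2 i * (g.a i : ℕ))), ?_, ?_⟩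
  · exact Finset.prod_ne_zero_iff.2 fun i _ =>
      div_ne_zero (pow_ne_zero _ (omega_ne_zero d)) (pow_ne_zero _ (omega_ne_zero d))
  · rw [op_eq_tensorOp, multiWeyl, tensorOp_mul, tensorOp_mul, ← tensorOp_smul]
    congr 1
    funext i
    exact weyl_mul_weyl_comm d _ _ _ _

end MultiQudit

/-! ### Joint eigenspaces -/

section Unitary

variable {α : Type} [Fintype α] [DecidableEq α]

theorem toEuclideanLin_mul_apply (A B : Matrix α α ℂ) (v : EuclideanSpace ℂ α) :
    Matrix.toEuclideanLin (A * B) v = Matrix.toEuclideanLin A (Matrix.toEuclideanLin B v) := by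
  ext
  simp [Matrix.toLpLin_apply]

theorem toEuclideanLin_one_apply (v : EuclideanSpace ℂ α) :
    Matrix.toEuclideanLin (1 : Matrix α α ℂ) v = v := by
  simp

theorem inner_unitary {U : Matrix α α ℂ} (hU : U ∈ Matrix.unitaryGroup α ℂ)
    (u v : EuclideanSpace ℂ α) :
    inner ℂ (Matrix.toEuclideanLin U u) (Matrix.toEuclideanLin U v) = inner ℂ u v := by
  rw [← LinearMap.adjoint_inner_right, ← Matrix.toEuclideanLin_conjTranspose_eq_adjoint,
    ← toEuclideanLin_mul_apply, ← Matrix.star_eq_conjTranspose, Matrix.mem_unitaryGroup_iff'.1 hU,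
    toEuclideanLin_one_apply]

/-- Preservation of the inner product forces `conj a * a = 1`, and also `conj a * b = 1` unless the
two vectors are orthogonal. -/
theorem inner_eq_zero_of_unitary {U : Matrix α α ℂ} (hU : U ∈ Matrix.unitaryGroup α ℂ)
    {u v : EuclideanSpace ℂ α} {a b : ℂ} (hu : Matrix.toEuclideanLin U u = a • u)
    (hv : Matrix.toEuclideanLin U v = b • v) (hab : a ≠ b) : inner ℂ u v = 0 := by
  by_cases hu0 : u = 0
  · simp [hu0]
  have h1 := inner_unitary hU u u
  have h2 := inner_unitary hU u v
  rw [hu, inner_smul_left, inner_smul_right, ← mul_assoc] at h1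
  rw [hu, hv, inner_smul_left, inner_smul_right, ← mul_assoc] at h2
  have h3 : (starRingEnd ℂ) a * a = 1 := by
    have : inner ℂ u u ≠ (0 : ℂ) := inner_self_ne_zero.2 hu0
    exact mul_right_cancel₀ this (by rw [h1, one_mul])
  by_contra hne
  have h4 : (starRingEnd ℂ) a * b = 1 := mul_right_cancel₀ hne (by rw [h2, one_mul])
  have ha : (starRingEnd ℂ) a ≠ 0 := fun h => by simp [h] at h3
  exact hab (mul_left_cancel₀ ha (h3.trans h4.symm))

end Unitary

/-! ### Pauli strings move the joint eigenspaces around. -/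

section Joint

variable {ι κ : Type} [Fintype ι] [DecidableEq ι] {d : ℕ} [NeZero d] {g : κ → PauliElt ι d}

theorem mem_jointEigenspace {μ : κ → ℂ} {v : EuclideanSpace ℂ (ι → Fin d)} :
    v ∈ jointEigenspace g μ ↔ ∀ j, Matrix.toEuclideanLin (g j).op v = μ j • v := by
  simp [jointEigenspace, Submodule.mem_iInf]

theorem apply_mem_jointEigenspace {U : Matrix (ι → Fin d) (ι → Fin d) ℂ} {q : κ → ℂ}
    (hq : ∀ j, (g j).op * U = q j • (U * (g j).op)) {μ : κ → ℂ}
    {v : EuclideanSpace ℂ (ι → Fin d)} (hv : v ∈ jointEigenspace g μ) :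
    Matrix.toEuclideanLin U v ∈ jointEigenspace g fun j => q j * μ j := by
  rw [mem_jointEigenspace] at hv ⊢
  intro j
  rw [← toEuclideanLin_mul_apply, hq, map_smul, LinearMap.smul_apply, toEuclideanLin_mul_apply,
    hv, map_smul, smul_smul]

theorem finrank_jointEigenspace_le {U : Matrix (ι → Fin d) (ι → Fin d) ℂ}
    (hU : U ∈ Matrix.unitaryGroup (ι → Fin d) ℂ) {q : κ → ℂ}
    (hq : ∀ j, (g j).op * U = q j • (U * (g j).op)) (μ : κ → ℂ) :
    Module.finrank ℂ (jointEigenspace g μ) ≤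
      Module.finrank ℂ (jointEigenspace g fun j => q j * μ j) := by
  have hinj : Function.Injective (Matrix.toEuclideanLin U) := by
    refine Function.LeftInverse.injective (g := Matrix.toEuclideanLin (star U)) fun v => ?_
    rw [← toEuclideanLin_mul_apply, Matrix.mem_unitaryGroup_iff'.1 hU, toEuclideanLin_one_apply]
  exact LinearMap.finrank_le_finrank_of_injective
    (f := (Matrix.toEuclideanLin U).restrict fun v hv => apply_mem_jointEigenspace hq hv)
    fun u v huv => Subtype.ext (hinj (congrArg Subtype.val huv))

theorem finrank_jointEigenspace_eq {U : Matrix (ι → Fin d) (ι → Fin d) ℂ}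
    (hU : U ∈ Matrix.unitaryGroup (ι → Fin d) ℂ) {q : κ → ℂ} (hq0 : ∀ j, q j ≠ 0)
    (hq : ∀ j, (g j).op * U = q j • (U * (g j).op)) (μ : κ → ℂ) :
    Module.finrank ℂ (jointEigenspace g fun j => q j * μ j) =
      Module.finrank ℂ (jointEigenspace g μ) := by
  refine le_antisymm ?_ (finrank_jointEigenspace_le hU hq μ)
  have hq' : ∀ j, (g j).op * star U = (q j)⁻¹ • (star U * (g j).op) := by
    intro j
    have h1 := Matrix.mem_unitaryGroup_iff.1 hU
    have h2 := Matrix.mem_unitaryGroup_iff'.1 hU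
    calc (g j).op * star U = (star U * U) * (g j).op * star U := by rw [h2, one_mul]
      _ = star U * ((q j)⁻¹ • ((g j).op * U)) * star U := by
        rw [hq, smul_smul, inv_mul_cancel₀ (hq0 j), one_smul, mul_assoc (star U)]
      _ = (q j)⁻¹ • (star U * (g j).op * (U * star U)) := by
        simp only [Matrix.mul_smul, Matrix.smul_mul, mul_assoc]
      _ = _ := by rw [h1, mul_one]
  have hU' : star U ∈ Matrix.unitaryGroup (ι → Fin d) ℂ := by
    rw [Matrix.mem_unitaryGroup_iff, star_star]
    exact Matrix.mem_unitaryGroup_iff'.1 hU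
  have := finrank_jointEigenspace_le hU' hq' fun j => q j * μ j
  rwa [show (fun j => (q j)⁻¹ * (q j * μ j)) = μ from
    funext fun j => inv_mul_cancel_left₀ (hq0 j) _] at this

theorem jointEigenspace_isOrtho {μ ν : κ → ℂ} (h : μ ≠ ν) :
    jointEigenspace g μ ⟂ jointEigenspace g ν := by
  obtain ⟨j, hj⟩ := Function.ne_iff.1 h
  rw [Submodule.isOrtho_iff_inner_eq]
  intro u hu v hv
  exact inner_eq_zero_of_unitary (op_mem_unitaryGroup (g j)) (mem_jointEigenspace.1 hu j)
    (mem_jointEigenspace.1 hv j) hj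

theorem exists_phases (g : κ → PauliElt ι d) (e : (ι → ℕ) × (ι → ℕ)) :
    ∃ q : κ → ℂ, (∀ j, q j ≠ 0) ∧
      ∀ j, (g j).op * multiWeyl d e = q j • (multiWeyl d e * (g j).op) := by
  choose q h0 h using fun j => op_mul_multiWeyl (g j) e
  exact ⟨q, h0, h⟩

theorem finrank_eq_of_ne_bot {μ ν : κ → ℂ} (hμ : jointEigenspace g μ ≠ ⊥)
    (hν : jointEigenspace g ν ≠ ⊥) :
    Module.finrank ℂ (jointEigenspace g μ) = Module.finrank ℂ (jointEigenspace g ν) := by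
  obtain ⟨v, hv, hv0⟩ := Submodule.exists_mem_ne_zero_of_ne_bot hμ
  obtain ⟨f, hf, hf0⟩ := Submodule.exists_mem_ne_zero_of_ne_bot hν
  -- Some string must move `v` to a vector not orthogonal to `f`; otherwise `f` would be orthogonal
  -- to the whole space.
  obtain ⟨e, he⟩ : ∃ e, inner ℂ (Matrix.toEuclideanLin (multiWeyl d e) v) f ≠ 0 := by
    by_contra! h
    have hmem : f ∈ (Submodule.span ℂ (Set.range fun e =>
        Matrix.toEuclideanLin (multiWeyl (ι := ι) d e) v))ᗮ := by
      rw [Submodule.mem_orthogonal]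
      intro u hu
      induction hu using Submodule.span_induction with
      | mem x hx =>
        obtain ⟨e, rfl⟩ := hx
        exact h e
      | zero => simp
      | add x y _ _ hx hy => rw [inner_add_left, hx, hy, add_zero]
      | smul a x _ hx => rw [inner_smul_left, hx, mul_zero]
    rw [span_multiWeyl_apply hv0, Submodule.top_orthogonal_eq_bot] at hmem
    exact hf0 hmem
  obtain ⟨q, hq0, hq⟩ := exists_phases g e
  have hmem := apply_mem_jointEigenspace hq hv
  -- The moved vector lies in the joint eigenspace for `q j * μ j`. Different eigenvalue tuples give
  -- orthogonal spaces, so this tuple is `ν`.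
  have hν' : (fun j => q j * μ j) = ν := by
    by_contra hne
    exact he ((Submodule.isOrtho_iff_inner_eq.1 (jointEigenspace_isOrtho hne)) _ hmem _ hf)
  rw [← hν', finrank_jointEigenspace_eq (multiWeyl_mem_unitaryGroup e) hq0 hq]

theorem sSup_jointEigenspaces {μ : κ → ℂ} (hμ : jointEigenspace g μ ≠ ⊥) :
    sSup (jointEigenspaces g) = ⊤ := by
  obtain ⟨v, hv, hv0⟩ := Submodule.exists_mem_ne_zero_of_ne_bot hμ
  rw [eq_top_iff, ← span_multiWeyl_apply hv0, Submodule.span_le]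
  rintro _ ⟨e, rfl⟩
  obtain ⟨q, hq0, hq⟩ := exists_phases g e
  have hmem := apply_mem_jointEigenspace hq hv
  by_cases h0 : jointEigenspace g (fun j => q j * μ j) = ⊥
  · rw [h0, Submodule.mem_bot] at hmem
    simp only [hmem]
    exact Submodule.zero_mem _
  · exact le_sSup (show _ ∈ jointEigenspaces g from ⟨h0, _, rfl⟩) hmem

theorem jointEigenspaces_isOrtho {E F : Submodule ℂ (EuclideanSpace ℂ (ι → Fin d))}
    (hE : E ∈ jointEigenspaces g) (hF : F ∈ jointEigenspaces g) (h : E ≠ F) : E ⟂ F := by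
  obtain ⟨-, μ, rfl⟩ := hE
  obtain ⟨-, ν, rfl⟩ := hF
  exact jointEigenspace_isOrtho fun hμ => h (by rw [hμ])

end Joint

/-- A family of pairwise orthogonal nonzero subspaces of the same dimension `b` that spans the
space has `dim / b` members. -/
theorem finite_and_ncard_mul_of_isOrtho {V : Type} [NormedAddCommGroup V] [InnerProductSpace ℂ V]
    [FiniteDimensional ℂ V] {𝒮 : Set (Submodule ℂ V)} {b : ℕ}
    (hbot : ∀ E ∈ 𝒮, E ≠ ⊥) (hdim : ∀ E ∈ 𝒮, Module.finrank ℂ E = b)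
    (hortho : ∀ E ∈ 𝒮, ∀ F ∈ 𝒮, E ≠ F → E ⟂ F) (htop : sSup 𝒮 = ⊤) :
    𝒮.Finite ∧ 𝒮.ncard * b = Module.finrank ℂ V := by
  classical
  have hfam : OrthogonalFamily ℂ (fun E : 𝒮 => E.1) fun E => E.1.subtypeₗᵢ :=
    OrthogonalFamily.of_pairwise fun E F h =>
      hortho E.1 E.2 F.1 F.2 fun h' => h (Subtype.ext h')
  have hind := hfam.independent
  have hfin : Finite 𝒮 := by
    have := WellFoundedGT.finite_ne_bot_of_iSupIndep hind
    have huniv : {E : 𝒮 | E.1 ≠ ⊥} = Set.univ := Set.eq_univ_of_forall fun E => hbot E.1 E.2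
    rw [huniv] at this
    exact Set.finite_univ_iff.1 this
  have := Fintype.ofFinite 𝒮
  have hint : DirectSum.IsInternal fun E : 𝒮 => E.1 := by
    rw [DirectSum.isInternal_submodule_iff_iSupIndep_and_iSup_eq_top]
    exact ⟨hind, by rw [← sSup_eq_iSup', htop]⟩
  refine ⟨Set.toFinite 𝒮, ?_⟩
  have h1 := (LinearEquiv.ofBijective (DirectSum.coeLinearMap fun E : 𝒮 => E.1) hint).finrank_eq
  rw [Module.finrank_directSum] at h1
  rw [← h1, Finset.sum_congr rfl fun E _ => hdim E.1 E.2, Finset.sum_const, smul_eq_mul,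
    Finset.card_univ, ← Nat.card_eq_fintype_card, Nat.card_coe_set_eq]

/-! ### Spectral projections of unitaries of finite order -/

section EigProj

variable {α β : Type} [Fintype α] [DecidableEq α] {d : ℕ}

/-- The average of the powers of `U`, for `U ^ d = 1` the projection onto the fixed vectors. -/
def avg (d : ℕ) (U : Matrix α α ℂ) : Matrix α α ℂ := (d : ℂ)⁻¹ • ∑ m ∈ Finset.range d, U ^ m

theorem pow_mul_of_eigen {U : Matrix α α ℂ} {X : Matrix α β ℂ} {c : ℂ} (h : U * X = c • X)
    (m : ℕ) : U ^ m * X = c ^ m • X := by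
  induction m with
  | zero => simp
  | succ m ih => rw [pow_succ, Matrix.mul_assoc, h, Matrix.mul_smul, ih, smul_smul, pow_succ']

theorem avg_mul_of_fixed [NeZero d] {U : Matrix α α ℂ} {X : Matrix α β ℂ} (h : U * X = X) :
    avg d U * X = X := by
  have hd : (d : ℂ) ≠ 0 := Nat.cast_ne_zero.2 (NeZero.ne d)
  have h' : U * X = (1 : ℂ) • X := by rw [h, one_smul]
  simp [avg, Matrix.sum_mul, pow_mul_of_eigen h', ← Nat.cast_smul_eq_nsmul ℂ, smul_smul, hd]

theorem avg_mul_eq_zero {U : Matrix α α ℂ} {X : Matrix α β ℂ} {c : ℂ} (h : U * X = c • X)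
    (hc : c ^ d = 1) (hc1 : c ≠ 1) : avg d U * X = 0 := by
  simp only [avg, Matrix.smul_mul, Matrix.sum_mul, pow_mul_of_eigen h, ← Finset.sum_smul]
  rw [geom_sum_eq hc1, hc, sub_self, zero_div, zero_smul, smul_zero]

theorem mul_avg {U : Matrix α α ℂ} (h : U ^ d = 1) : U * avg d U = avg d U := by
  rw [avg, Matrix.mul_smul]
  congr 1
  -- Split off the last and the first term of the sum of `U ^ m` over `m ≤ d`: both are 1, so the
  -- remaining sums agree.
  have h1 := Finset.sum_range_succ (fun m => U ^ m) d
  rw [Finset.sum_range_succ', h, pow_zero] at h1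
  rw [Finset.mul_sum, ← add_right_cancel h1]
  exact Finset.sum_congr rfl fun m _ => (pow_succ' U m).symm

theorem star_avg (U : Matrix α α ℂ) : star (avg d U) = avg d (star U) := by
  simp [avg, star_sum, star_smul, star_pow]

/-- `star U` fixes the range of `avg d U`, so its average, which is the adjoint of `avg d U`, does
too. Thus the average equals `star (avg d U) * avg d U`, which makes it self-adjoint. -/
theorem avg_isStarProjection [NeZero d] {U : Matrix α α ℂ} (h : U ^ d = 1)
    (hU : U ∈ Matrix.unitaryGroup α ℂ) : IsStarProjection (avg d U) := by
  have h1 : star U * avg d U = avg d U := by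
    conv_lhs => rw [← mul_avg h, ← mul_assoc, Matrix.mem_unitaryGroup_iff'.1 hU, one_mul]
  have h2 : star (avg d U) * avg d U = avg d U := by
    rw [star_avg]
    exact avg_mul_of_fixed h1
  refine ⟨avg_mul_of_fixed (mul_avg h), ?_⟩
  rw [← h2]
  exact IsSelfAdjoint.star_mul_self _

theorem avg_semiconj {U U' X : Matrix α α ℂ} (h : U' * X = X * U) :
    avg d U' * X = X * avg d U := by
  have hs : SemiconjBy X U U' := h.symm
  simp only [avg, Matrix.smul_mul, Matrix.mul_smul, Finset.sum_mul, Finset.mul_sum]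
  congr 1
  exact Finset.sum_congr rfl fun m _ => ((hs.pow_right m).eq).symm

/-- The projection onto the eigenspace of `U` for the eigenvalue `c`, when `U ^ d = c ^ d = 1`. -/
def eigProj (d : ℕ) (c : ℂ) (U : Matrix α α ℂ) : Matrix α α ℂ := avg d (c⁻¹ • U)

theorem ne_zero_of_pow_eq_one [NeZero d] {c : ℂ} (h : c ^ d = 1) : c ≠ 0 := by
  rintro rfl
  rw [zero_pow (NeZero.ne d)] at h
  exact zero_ne_one h

theorem star_mul_self_of_pow_eq_one [NeZero d] {c : ℂ} (h : c ^ d = 1) : star c * c = 1 := by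
  rw [Complex.star_def, mul_comm, Complex.mul_conj, Complex.normSq_eq_norm_sq,
    Complex.norm_eq_one_of_pow_eq_one h (NeZero.ne d)]
  simp

theorem smul_mem_unitaryGroup [NeZero d] {c : ℂ} (h : c ^ d = 1) {U : Matrix α α ℂ}
    (hU : U ∈ Matrix.unitaryGroup α ℂ) : c • U ∈ Matrix.unitaryGroup α ℂ := by
  rw [Matrix.mem_unitaryGroup_iff', star_smul, Matrix.smul_mul, Matrix.mul_smul, smul_smul,
    Matrix.mem_unitaryGroup_iff'.1 hU, star_mul_self_of_pow_eq_one h, one_smul]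

variable [NeZero d] {U : Matrix α α ℂ} {c : ℂ}

theorem eigProj_isStarProjection (hc : c ^ d = 1) (h : U ^ d = 1)
    (hU : U ∈ Matrix.unitaryGroup α ℂ) : IsStarProjection (eigProj d c U) := by
  have hc' : c⁻¹ ^ d = 1 := by rw [inv_pow, hc, inv_one]
  exact avg_isStarProjection (by rw [smul_pow, hc', h, one_smul]) (smul_mem_unitaryGroup hc' hU)

theorem mul_eigProj (hc : c ^ d = 1) (h : U ^ d = 1) : U * eigProj d c U = c • eigProj d c U := by
  have h1 : (c⁻¹ • U) ^ d = 1 := by rw [smul_pow, inv_pow, hc, h, inv_one, one_smul]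
  have h2 := mul_avg h1
  rw [Matrix.smul_mul, inv_smul_eq_iff₀ (ne_zero_of_pow_eq_one hc)] at h2
  exact h2

theorem eigProj_mul_of_eigen (hc : c ^ d = 1) {X : Matrix α β ℂ} (h : U * X = c • X) :
    eigProj d c U * X = X := by
  refine avg_mul_of_fixed ?_
  rw [Matrix.smul_mul, h, inv_smul_smul₀ (ne_zero_of_pow_eq_one hc)]

theorem eigProj_mul_eq_zero {b : ℂ} (hc : c ^ d = 1) (hb : b ^ d = 1) (hbc : b ≠ c)
    {X : Matrix α β ℂ} (h : U * X = b • X) : eigProj d c U * X = 0 := by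
  refine avg_mul_eq_zero (c := c⁻¹ * b) ?_ ?_ ?_
  · rw [Matrix.smul_mul, h, smul_smul]
  · rw [mul_pow, inv_pow, hc, hb, inv_one, one_mul]
  · rw [Ne, inv_mul_eq_one₀ (ne_zero_of_pow_eq_one hc)]
    exact hbc.symm

theorem eigProj_mul_of_comm {V : Matrix α α ℂ} {q : ℂ} (hq : q ≠ 0) (h : V * U = q • (U * V)) :
    eigProj d (q * c) V * U = U * eigProj d c V := by
  refine avg_semiconj ?_
  rw [Matrix.smul_mul, h, smul_smul, mul_inv, mul_right_comm, inv_mul_cancel₀ hq, one_mul,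
    Matrix.mul_smul]

/-- Summing over all roots of unity annihilates every power `U ^ m` with `0 < m < d`, whatever `U`
is; only the constant term survives. -/
theorem sum_eigProj (U : Matrix α α ℂ) :
    ∑ x : Fin d, eigProj d (omega d ^ (x : ℕ)) U = 1 := by
  have hd : (d : ℂ) ≠ 0 := Nat.cast_ne_zero.2 (NeZero.ne d)
  have hw := omega_primitive d
  simp only [eigProj, avg, smul_pow]
  rw [← Finset.smul_sum, Finset.sum_comm]
  simp only [← Finset.sum_smul]
  have key : ∀ m ∈ Finset.range d, (∑ x : Fin d, ((omega d ^ (x : ℕ))⁻¹) ^ m) • U ^ m =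
      if m = 0 then (d : ℂ) • (1 : Matrix α α ℂ) else 0 := by
    intro m hm
    have h1 : ((omega d ^ m)⁻¹) ^ d = 1 := by
      rw [inv_pow, ← pow_mul, mul_comm, pow_mul, hw.pow_eq_one, one_pow, inv_one]
    have h2 : (omega d ^ m)⁻¹ = 1 ↔ m = 0 := by
      rw [inv_eq_one]
      refine ⟨fun h => ?_, fun h => by rw [h, pow_zero]⟩
      exact hw.pow_inj (Finset.mem_range.1 hm) (NeZero.pos d) (by rw [h, pow_zero])
    have h3 := geom_sum_root d h1
    simp only [h2] at h3
    have h4 : ∀ x : Fin d, ((omega d ^ (x : ℕ))⁻¹) ^ m = ((omega d ^ m)⁻¹) ^ (x : ℕ) := by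
      intro x
      rw [inv_pow, inv_pow, ← pow_mul, ← pow_mul, mul_comm]
    simp only [h4]
    rw [h3]
    split_ifs with h
    · rw [h, pow_zero]
    · rw [zero_smul]
  rw [Finset.sum_congr rfl key, Finset.sum_ite_eq' (Finset.range d) 0,
    if_pos (Finset.mem_range.2 (NeZero.pos d)), smul_smul, inv_mul_cancel₀ hd, one_smul]

end EigProj

/-! ### Projections onto joint eigenspaces -/

section JointProjection

variable {ι κ : Type} [Fintype ι] [DecidableEq ι] {d : ℕ} [NeZero d] {g : κ → PauliElt ι d}

theorem pow_eq_one_of_mul_eq_smul {α β : Type} [Fintype α] [DecidableEq α] {U : Matrix α α ℂ}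
    {X : Matrix α β ℂ} {c : ℂ} (hX : X ≠ 0) (hU : U ^ d = 1) (h : U * X = c • X) : c ^ d = 1 := by
  have h1 := pow_mul_of_eigen h d
  rw [hU, Matrix.one_mul] at h1
  have h2 : (1 - c ^ d) • X = 0 := by rw [sub_smul, one_smul, ← h1, sub_self]
  exact (sub_eq_zero.1 ((smul_eq_zero.1 h2).resolve_right hX)).symm

/-- Encodes a vector as a matrix with equal columns, so that the eigenvector lemmas stated for
matrix products apply to vectors. -/
theorem mul_of_const_eq_smul_iff {α : Type} [Fintype α] [DecidableEq α] (A : Matrix α α ℂ)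
    (v : EuclideanSpace ℂ α) (c : ℂ) :
    A * Matrix.of (fun r (_ : α) => v r) = c • Matrix.of (fun r (_ : α) => v r) ↔
      Matrix.toEuclideanLin A v = c • v := by
  constructor
  · intro h
    ext r
    simpa [Matrix.mul_apply, Matrix.mulVec, dotProduct] using congrFun (congrFun h r) r
  · intro h
    ext r s
    simpa [Matrix.mul_apply, Matrix.mulVec, dotProduct] using congrArg (fun w => w.ofLp r) h

/-- The product of the commuting spectral projections of the generators. Each factor is a polynomial
in its generator, and this membership in the generated algebra is what controls the partial
transpose later. -/
theorem exists_joint_projection (hcomm : ∀ j l, Commute (g j).op (g l).op) {μ : κ → ℂ}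
    (hμ : ∀ j, μ j ^ d = 1) (s : Finset κ) :
    ∃ P ∈ Algebra.adjoin ℂ (Set.range fun j => (g j).op), IsStarProjection P ∧
      (∀ j ∈ s, (g j).op * P = μ j • P) ∧
      ∀ X : Matrix (ι → Fin d) (ι → Fin d) ℂ, (∀ j ∈ s, (g j).op * X = μ j • X) → P * X = X := by
  classical
  induction s using Finset.induction_on with
  | empty => exact ⟨1, one_mem _, IsStarProjection.one _, by simp, by simp⟩
  | insert j s hj ih =>
    obtain ⟨P, hP, hproj, heig, hfix⟩ := ih
    have hc : ∀ l, Commute (g l).op P := by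
      intro l
      refine Algebra.commute_of_mem_adjoin_of_forall_mem_commute hP ?_
      rintro _ ⟨j, rfl⟩
      exact hcomm l j
    have hcE : ∀ X, Commute (g j).op X → Commute (eigProj d (μ j) (g j).op) X := by
      intro X hX
      refine avg_semiconj ?_
      rw [Matrix.smul_mul, Matrix.mul_smul, hX.eq]
    refine ⟨eigProj d (μ j) (g j).op * P, mul_mem ?_ hP, ?_, ?_, ?_⟩
    · exact Subalgebra.smul_mem _ (sum_mem fun m _ => pow_mem (Subalgebra.smul_mem _
        (Algebra.subset_adjoin (Set.mem_range_self j)) _) _) _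
    · exact (eigProj_isStarProjection (hμ j) (op_pow_dim _) (op_mem_unitaryGroup _)).mul hproj
        (hcE P (hc j))
    · intro l hl
      rcases Finset.mem_insert.1 hl with rfl | hl
      · rw [← mul_assoc, mul_eigProj (hμ l) (op_pow_dim _), Matrix.smul_mul]
      · rw [← mul_assoc, ← (hcE _ (hcomm j l)).eq, mul_assoc, heig l hl, Matrix.mul_smul]
    · intro X hX
      rw [mul_assoc, hfix X fun l hl => hX l (Finset.mem_insert_of_mem hl)]
      exact eigProj_mul_of_eigen (hμ j) (hX j (Finset.mem_insert_self _ _))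

/-- The orthogonal projection onto a nonzero joint eigenspace is a star projection in the algebra
generated by the `g j`. -/
theorem projMatrix_spec [Fintype κ] (hcomm : ∀ j l, Commute (g j).op (g l).op) {μ : κ → ℂ}
    (hE : jointEigenspace g μ ≠ ⊥) :
    (∀ j, μ j ^ d = 1) ∧
    projMatrix (jointEigenspace g μ) ∈ Algebra.adjoin ℂ (Set.range fun j => (g j).op) ∧
    IsStarProjection (projMatrix (jointEigenspace g μ)) ∧
    (∀ j, (g j).op * projMatrix (jointEigenspace g μ) =
      μ j • projMatrix (jointEigenspace g μ)) ∧
    projMatrix (jointEigenspace g μ) ≠ 0 := by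
  obtain ⟨v, hv, hv0⟩ := Submodule.exists_mem_ne_zero_of_ne_bot hE
  have hX0 : Matrix.of (fun r (_ : ι → Fin d) => v r) ≠ 0 := by
    intro h
    exact hv0 (PiLp.ext fun r => congrFun (congrFun h r) r)
  have hX := fun j => (mul_of_const_eq_smul_iff _ _ _).2 (mem_jointEigenspace.1 hv j)
  have hμ : ∀ j, μ j ^ d = 1 := fun j => pow_eq_one_of_mul_eq_smul hX0 (op_pow_dim (g j)) (hX j)
  obtain ⟨P, hP, hproj, heig, hfix⟩ := exists_joint_projection hcomm hμ Finset.univ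
  have hadj : LinearMap.adjoint (Matrix.toEuclideanLin P) = Matrix.toEuclideanLin P := by
    rw [← Matrix.toEuclideanLin_conjTranspose_eq_adjoint]
    exact congrArg _ hproj.isSelfAdjoint
  have heq : projMatrix (jointEigenspace g μ) = P := by
    ext x y
    have : (jointEigenspace g μ).starProjection (EuclideanSpace.single y 1) =
        Matrix.toEuclideanLin P (EuclideanSpace.single y 1) := by
      refine Submodule.eq_starProjection_of_mem_of_inner_eq_zero (K := jointEigenspace g μ) ?_ ?_
      · rw [mem_jointEigenspace]
        intro j
        rw [← toEuclideanLin_mul_apply, heig j (Finset.mem_univ j), map_smul,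
          LinearMap.smul_apply]
      · intro w hw
        have hw' : Matrix.toEuclideanLin P w = w := by
          have := (mul_of_const_eq_smul_iff P w 1).1 (by
            rw [one_smul]
            exact hfix _ fun j _ => (mul_of_const_eq_smul_iff _ _ _).2 (mem_jointEigenspace.1 hw j))
          rwa [one_smul] at this
        rw [← hw', ← LinearMap.adjoint_inner_left, hadj, map_sub, ← toEuclideanLin_mul_apply,
          hproj.isIdempotentElem.eq, sub_self, inner_zero_left]
    rw [projMatrix, this]
    simp
  rw [heq]
  refine ⟨hμ, hP, hproj, fun j => heig j (Finset.mem_univ j), ?_⟩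
  rintro rfl
  exact hX0 (by rw [← hfix _ fun j _ => hX j, Matrix.zero_mul])

theorem posSemidef_of_isStarProjection {α : Type} [Fintype α] [DecidableEq α] {P : Matrix α α ℂ}
    (h : IsStarProjection P) : P.PosSemidef := by
  have h1 : P = P.conjTranspose * P := by
    rw [← Matrix.star_eq_conjTranspose, h.isSelfAdjoint.star_eq, h.isIdempotentElem.eq]
  rw [h1]
  exact Matrix.posSemidef_conjTranspose_mul_self P

theorem maxMixed_isDensity {α : Type} [Fintype α] [DecidableEq α]
    {E : Submodule ℂ (EuclideanSpace ℂ α)} (h : IsStarProjection (projMatrix E))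
    (h0 : projMatrix E ≠ 0) : 0 < (projMatrix E).trace ∧ IsDensity (maxMixed E) := by
  have hpsd := posSemidef_of_isStarProjection h
  have hpos : 0 < (projMatrix E).trace :=
    lt_of_le_of_ne hpsd.trace_nonneg fun h1 => h0 (hpsd.trace_eq_zero_iff.1 h1.symm)
  refine ⟨hpos, hpsd.smul (inv_nonneg.2 hpos.le), ?_⟩
  rw [maxMixed, Matrix.trace_smul, smul_eq_mul, inv_mul_cancel₀ hpos.ne']

/-! ### Positivity of the partial transpose -/

variable (S : ι → Prop) [DecidablePred S]

/-- A word in the generators need not have exponents of the form required by `PauliElt`. It is kept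
as a product operator together with its commutation phases with each generator; these multiply along
the word, so their product over `S` stays 1. -/
theorem exists_tensorOp_of_mem_closure
    (hS : ∀ j l, ∏ i with S i, phase (g j) (g l) i = 1) {w : Matrix (ι → Fin d) (ι → Fin d) ℂ}
    (hw : w ∈ Submonoid.closure (Set.range fun j => (g j).op)) :
    ∃ (A : ι → Matrix (Fin d) (Fin d) ℂ) (r : κ → ι → ℂ),
      w = tensorOp (H := fun _ => Fin d) (H' := fun _ => Fin d) A ∧
      (∀ j i, site (g j) i * A i = r j i • (A i * site (g j) i)) ∧
      ∀ j, ∏ i with S i, r j i = 1 := by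
  induction hw using Submonoid.closure_induction_left with
  | one => exact ⟨fun _ => 1, fun _ _ => 1, tensorOp_one.symm, by simp, by simp⟩
  | mul_left x hx y hy ih =>
    obtain ⟨l, rfl⟩ := hx
    obtain ⟨A, r, rfl, hA, hr⟩ := ih
    refine ⟨fun i => site (g l) i * A i, fun j i => phase (g j) (g l) i * r j i, ?_, ?_, ?_⟩
    · exact tensorOp_mul _ _
    · intro j i
      rw [← mul_assoc, site_mul_site, Matrix.smul_mul, mul_assoc, hA, Matrix.mul_smul, smul_smul,
        mul_assoc]
    · intro j
      rw [Finset.prod_mul_distrib, hS, hr, one_mul]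

/-- Transposition reverses the order of the factors on `S`. Restoring the order costs one phase per
qudit of `S`, and these phases multiply to 1. -/
theorem partialTranspose_op_mul
    (hS : ∀ j l, ∏ i with S i, phase (g j) (g l) i = 1) {w : Matrix (ι → Fin d) (ι → Fin d) ℂ}
    (hw : w ∈ Submonoid.closure (Set.range fun j => (g j).op)) (j : κ) :
    partialTranspose (H := fun _ => Fin d) S ((g j).op * w) =
      partialTranspose (H := fun _ => Fin d) S (g j).op *
        partialTranspose (H := fun _ => Fin d) S w := by
  obtain ⟨A, r, rfl, hA, hr⟩ := exists_tensorOp_of_mem_closure S hS hw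
  rw [op_eq_tensorOp, tensorOp_mul, partialTranspose_tensorOp, partialTranspose_tensorOp,
    partialTranspose_tensorOp, tensorOp_mul]
  have h1 := hr j
  rw [Finset.prod_filter] at h1
  -- Write the scalar 1 as the product of the phases over `S` and distribute it over the sites, so
  -- that the identity can be checked site by site.
  rw [← one_smul ℂ (tensorOp fun p => (if S p then _ else _) * _), ← h1, ← tensorOp_smul]
  congr 1
  funext i
  by_cases h : S i
  · simp only [h, if_true]
    rw [hA, Matrix.transpose_smul, Matrix.transpose_mul]
  · simp only [h, if_false, one_smul]

theorem partialTranspose_mul_of_mem_closure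
    (hS : ∀ j l, ∏ i with S i, phase (g j) (g l) i = 1) {v w : Matrix (ι → Fin d) (ι → Fin d) ℂ}
    (hv : v ∈ Submonoid.closure (Set.range fun j => (g j).op))
    (hw : w ∈ Submonoid.closure (Set.range fun j => (g j).op)) :
    partialTranspose (H := fun _ => Fin d) S (v * w) =
      partialTranspose (H := fun _ => Fin d) S v * partialTranspose (H := fun _ => Fin d) S w := by
  induction hv using Submonoid.closure_induction_left with
  | one =>
    have : partialTranspose (H := fun _ : ι => Fin d) S 1 = 1 := by
      rw [← tensorOp_one, partialTranspose_tensorOp]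
      simp
    rw [this, one_mul, one_mul]
  | mul_left x hx y hy ih =>
    obtain ⟨l, rfl⟩ := hx
    rw [mul_assoc, partialTranspose_op_mul S hS (mul_mem hy hw), ih,
      partialTranspose_op_mul S hS hy, mul_assoc]

theorem partialTranspose_mul_of_mem_adjoin
    (hS : ∀ j l, ∏ i with S i, phase (g j) (g l) i = 1) {v w : Matrix (ι → Fin d) (ι → Fin d) ℂ}
    (hv : v ∈ Algebra.adjoin ℂ (Set.range fun j => (g j).op))
    (hw : w ∈ Algebra.adjoin ℂ (Set.range fun j => (g j).op)) :
    partialTranspose (H := fun _ => Fin d) S (v * w) =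
      partialTranspose (H := fun _ => Fin d) S v * partialTranspose (H := fun _ => Fin d) S w := by
  rw [← Subalgebra.mem_toSubmodule, Algebra.adjoin_eq_span] at hv hw
  have pt0 : partialTranspose (H := fun _ : ι => Fin d) S 0 = 0 := rfl
  induction hv, hw using Submodule.span_induction₂ with
  | mem_mem x y hx hy => exact partialTranspose_mul_of_mem_closure S hS hx hy
  | zero_left y hy => simp [pt0]
  | zero_right x hx => simp [pt0]
  | add_left x y z _ _ _ h1 h2 => simp only [add_mul, partialTranspose_add, h1, h2]
  | add_right x y z _ _ _ h1 h2 => simp only [mul_add, partialTranspose_add, h1, h2]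
  | smul_left c x y _ _ h => simp only [Matrix.smul_mul, partialTranspose_smul, h]
  | smul_right c x y _ _ h => simp only [Matrix.mul_smul, partialTranspose_smul, h]

/-- Multiplicativity keeps `P` idempotent, and partial transposition commutes with the adjoint, so
the result is again a projection. -/
theorem partialTranspose_posSemidef
    (hS : ∀ j l, ∏ i with S i, phase (g j) (g l) i = 1) {P : Matrix (ι → Fin d) (ι → Fin d) ℂ}
    (hP : P ∈ Algebra.adjoin ℂ (Set.range fun j => (g j).op)) (h : IsStarProjection P) :
    (partialTranspose (H := fun _ => Fin d) S P).PosSemidef := by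
  refine posSemidef_of_isStarProjection ⟨?_, ?_⟩
  · change _ * _ = _
    rw [← partialTranspose_mul_of_mem_adjoin S hS hP hP, h.isIdempotentElem.eq]
  · change star _ = _
    rw [Matrix.star_eq_conjTranspose, partialTranspose_conjTranspose,
      ← Matrix.star_eq_conjTranspose, h.isSelfAdjoint.star_eq]

end JointProjection

/-! ### Invariants of LOCC protocols -/

section Protocol

variable {P : Type} [Fintype P] [DecidableEq P] {out : P → Type} [∀ p, Fintype (out p)]
  [∀ p, DecidableEq (out p)]

theorem sum_tensorOp_instrument {H H' : P → Type} [∀ p, Fintype (H p)] [∀ p, DecidableEq (H p)]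
    [∀ p, Fintype (H' p)] (M : ∀ p, Instrument (H p) (H' p)) :
    ∑ s : ∀ p, Fin (M p).m, (tensorOp fun p => (M p).K (s p)).conjTranspose *
      (tensorOp fun p => (M p).K (s p)) = 1 := by
  simp only [tensorOp_conjTranspose, tensorOp_mul]
  rw [sum_tensorOp fun p s => ((M p).K s).conjTranspose * (M p).K s]
  simp only [(M _).complete, tensorOp_one]

theorem LOCC.trace_run {H : P → Type} [∀ p, Fintype (H p)] [∀ p, DecidableEq (H p)]
    (Λ : LOCC out H) (ρ : Matrix (∀ p, H p) (∀ p, H p) ℂ) : (Λ.run ρ).trace = ρ.trace := by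
  induction Λ with
  | done => rfl
  | round M next ih =>
    simp only [LOCC.run, Matrix.trace_sum, ih]
    rw [Finset.sum_congr rfl fun s _ => Matrix.trace_mul_cycle _ ρ _, ← Matrix.trace_sum,
      ← Finset.sum_mul, sum_tensorOp_instrument, Matrix.one_mul]

/-- In each round the partial transpose is only conjugated by another product operator and then
summed over outcomes. -/
theorem LOCC.posSemidef_run {H : P → Type} [∀ p, Fintype (H p)] [∀ p, DecidableEq (H p)]
    (S : P → Prop) [DecidablePred S] (Λ : LOCC out H) (ρ : Matrix (∀ p, H p) (∀ p, H p) ℂ)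
    (h : (partialTranspose S ρ).PosSemidef) : (partialTranspose S (Λ.run ρ)).PosSemidef := by
  induction Λ with
  | done => exact h
  | round M next ih =>
    simp only [LOCC.run, partialTranspose_sum]
    refine Matrix.posSemidef_sum _ fun s _ => ih s _ ?_
    rw [partialTranspose_conj]
    exact h.mul_mul_conjTranspose_same _

theorem re_add_le_of_posSemidef {α : Type} [Fintype α] [DecidableEq α] {N : Matrix α α ℂ}
    (hN : N.PosSemidef) (a b : α) : (N a b + N b a).re ≤ (N a a + N b b).re := by
  -- The quadratic form at the difference of the basis vectors `a` and `b` is the difference of the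
  -- two sides.
  have h := hN.re_dotProduct_nonneg (Pi.single a 1 - Pi.single b 1)
  simp only [star_sub, Matrix.mulVec_sub, sub_dotProduct, dotProduct_sub, Pi.star_single, star_one,
    single_one_dotProduct, Matrix.mulVec_single_one, Matrix.col_apply] at h
  simp only [map_sub, RCLike.re_to_complex, Complex.add_re] at h ⊢
  linarith

/-- The configuration `z` with the components at `A` and `B` replaced. -/
def setPair (A B : P) (z : P → Fin 2) (r s : Fin 2) : P → Fin 2 :=
  Function.update (Function.update z A r) B s

theorem trace_eq_sum_setPair {A B : P} (hAB : A ≠ B) (σ : Matrix (P → Fin 2) (P → Fin 2) ℂ) :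
    σ.trace = ∑ z : P → Fin 2 with z A = 0 ∧ z B = 0, ∑ r : Fin 2, ∑ s : Fin 2,
      σ (setPair A B z r s) (setPair A B z r s) := by
  simp only [← Fintype.sum_prod_type']
  rw [← Finset.sum_product']
  symm
  refine Finset.sum_nbij' (fun q => setPair A B q.1 q.2.1 q.2.2)
    (fun x => (setPair A B x 0 0, (x A, x B))) ?_ ?_ ?_ ?_ ?_
  · simp
  · simp [setPair, hAB]
  · rintro ⟨z, r, s⟩ hz
    simp only [Finset.mem_product, Finset.mem_filter, Finset.mem_univ, true_and, and_true] at hz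
    simp only [setPair, Prod.mk.injEq]
    refine ⟨?_, by simp [hAB], by simp⟩
    funext p
    by_cases hB : p = B
    · subst hB
      simp [hz.2]
    by_cases hA : p = A
    · subst hA
      simp [hz.1, hB]
    · simp [hA, hB]
  · intro x _
    funext p
    by_cases hB : p = B
    · subst hB
      simp [setPair]
    by_cases hA : p = A
    · subst hA
      simp [setPair, hB]
    · simp [setPair, hA, hB]
  · simp

/-- Transposing `A` turns the coherence between `00` and `11` into one between `01` and `10`.
Positivity bounds that by the populations of `01` and `10`, so the fidelity sum is at most the
trace. -/
theorem bellFidelity_le_of_posSemidef {A B : P} (hAB : A ≠ B) (S : P → Prop) [DecidablePred S]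
    (hA : S A) (hB : ¬ S B) {σ : Matrix (P → Fin 2) (P → Fin 2) ℂ}
    (h : (partialTranspose (H := fun _ => Fin 2) S σ).PosSemidef) :
    bellFidelity (pairState σ A B) ≤ σ.trace.re / 2 := by
  set N := partialTranspose (H := fun _ => Fin 2) S σ with hN
  have hσ : ∀ z r s r' s', σ (setPair A B z r s) (setPair A B z r' s') =
      N (setPair A B z r' s) (setPair A B z r s') := by
    have hmix : ∀ z r s r' s', mix (H := fun _ => Fin 2) S (setPair A B z r' s)
        (setPair A B z r s') = setPair A B z r s := by
      intro z r s r' s'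
      funext p
      by_cases hpB : p = B
      · subst hpB
        simp [mix, setPair, hB]
      by_cases hpA : p = A
      · subst hpA
        simp [mix, setPair, hA, hAB]
      · simp [mix, setPair, hpA, hpB]
    intro z r s r' s'
    rw [hN, partialTranspose, hmix, hmix]
  have hF : ∑ r : Fin 2, ∑ c : Fin 2, pairState σ A B (r, r) (c, c) =
      ∑ z : P → Fin 2 with z A = 0 ∧ z B = 0, ∑ r : Fin 2, ∑ c : Fin 2,
        σ (setPair A B z r r) (setPair A B z c c) := by
    simp only [Fin.sum_univ_two, Finset.sum_add_distrib]
    rfl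
  rw [bellFidelity, hF, trace_eq_sum_setPair hAB, Complex.re_sum, Complex.re_sum]
  refine div_le_div_of_nonneg_right (Finset.sum_le_sum fun z _ => ?_) zero_le_two
  have key := re_add_le_of_posSemidef h (setPair A B z 0 1) (setPair A B z 1 0)
  simp only [Fin.sum_univ_two, hσ, Complex.add_re] at key ⊢
  linarith

end Protocol

/-! ### Copies of a state -/

section Copies

variable {ι : Type} [Fintype ι] [DecidableEq ι] {d : ℕ}
  {π : Finpartition (Finset.univ : Finset ι)}

/-- The block of `π` that contains `i`. -/
def blockOf (π : Finpartition (Finset.univ : Finset ι)) (i : ι) : {T // T ∈ π.parts} :=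
  ⟨π.part i, π.part_mem.2 (Finset.mem_univ i)⟩

theorem mem_blockOf (i : ι) : i ∈ (blockOf π i).1 := π.mem_part (Finset.mem_univ i)

theorem blockOf_eq {T : {T // T ∈ π.parts}} {i : ι} (h : i ∈ T.1) : blockOf π i = T :=
  Subtype.ext (π.part_eq_of_mem T.2 h)

/-- Configurations of the blocks, each with its qudits from `N` copies, regarded as configurations
of the `N` copies. -/
def gather (N : ℕ) :
    (∀ T : {T // T ∈ π.parts}, BlockSystem d N T) ≃ (Fin N → ι → Fin d) where
  toFun x t i := x (blockOf π i) t ⟨i, mem_blockOf i⟩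
  invFun y T t i := y t i
  left_inv x := by
    have : ∀ (T T' : {T // T ∈ π.parts}) (_ : T = T') (t : Fin N) (i : ι) (hi : i ∈ T.1)
        (hi' : i ∈ T'.1), x T t ⟨i, hi⟩ = x T' t ⟨i, hi'⟩ := by
      rintro T _ rfl t i hi hi'
      rfl
    funext T t i
    exact this _ _ (blockOf_eq i.2) t i _ _
  right_inv y := rfl

theorem copies_apply (ρ : Matrix (ι → Fin d) (ι → Fin d) ℂ) (N : ℕ)
    (x y : ∀ T : {T // T ∈ π.parts}, BlockSystem d N T) :
    copies ρ π N x y = ∏ t, ρ (gather N x t) (gather N y t) := rfl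

theorem trace_copies (ρ : Matrix (ι → Fin d) (ι → Fin d) ℂ) (N : ℕ) :
    (copies ρ π N).trace = ρ.trace ^ N := by
  have h : (copies ρ π N).trace = ∑ y : Fin N → ι → Fin d, ∏ t, ρ (y t) (y t) :=
    Fintype.sum_equiv (gather N) _ _ fun x => copies_apply ρ N x x
  rw [h, ← Fintype.piFinset_univ, ← Finset.prod_univ_sum (fun _ => Finset.univ) fun _ y => ρ y y]
  simp [Matrix.trace]

theorem posSemidef_copies {S : ι → Prop} [DecidablePred S] {S' : {T // T ∈ π.parts} → Prop}
    [DecidablePred S'] (hS : ∀ i, S' (blockOf π i) ↔ S i)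
    {ρ : Matrix (ι → Fin d) (ι → Fin d) ℂ}
    (h : (partialTranspose (H := fun _ => Fin d) S ρ).PosSemidef) (N : ℕ) :
    (partialTranspose S' (copies ρ π N)).PosSemidef := by
  have hmix : ∀ (x y : ∀ T : {T // T ∈ π.parts}, BlockSystem d N T) t,
      gather N (mix S' x y) t = mix (H := fun _ => Fin d) S (gather N x t) (gather N y t) := by
    intro x y t
    funext i
    by_cases hi : S i
    · simp [gather, mix, hi, hS]
    · simp [gather, mix, hi, hS]
  -- Up to regrouping the indices, transposing the copies together is transposing each copy
  -- separately.
  have heq : partialTranspose S' (copies ρ π N) =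
      (tensorOp (P := Fin N) (H := fun _ => ι → Fin d) (H' := fun _ => ι → Fin d) fun _ =>
        partialTranspose (H := fun _ => Fin d) S ρ).submatrix (gather N) (gather N) := by
    ext x y
    simp only [partialTranspose, copies_apply, hmix]
    rfl
  rw [heq]
  exact (tensorOp_posSemidef fun _ => h).submatrix _

theorem blockOf_bot (i : ι) : (blockOf (⊥ : Finpartition (Finset.univ : Finset ι)) i).1 = {i} := by
  have h := mem_blockOf (π := (⊥ : Finpartition (Finset.univ : Finset ι))) i
  obtain ⟨a, -, ha⟩ := Finpartition.mem_bot_iff.1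
    (blockOf (⊥ : Finpartition (Finset.univ : Finset ι)) i).2
  rw [← ha, Finset.mem_singleton] at h
  rw [← ha, h]

theorem exists_eq_blockOf_bot
    (A : {T // T ∈ (⊥ : Finpartition (Finset.univ : Finset ι)).parts}) :
    ∃ i, A = blockOf ⊥ i := by
  obtain ⟨a, -, ha⟩ := Finpartition.mem_bot_iff.1 A.2
  refine ⟨a, (blockOf_eq ?_).symm⟩
  rw [← ha]
  exact Finset.mem_singleton_self a

/-- A state with positive partial transpose on a set of qudits that contains `i` but not `j` is
not distillable between `i` and `j`. -/
theorem not_distillable_of_posSemidef {ρ : Matrix (ι → Fin d) (ι → Fin d) ℂ} (htr : ρ.trace = 1)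
    {i j : ι} (S : ι → Prop) [DecidablePred S] (hi : S i) (hj : ¬ S j)
    (h : (partialTranspose (H := fun _ => Fin d) S ρ).PosSemidef) :
    ¬ Distillable ρ ⊥ (blockOf ⊥ i) (blockOf ⊥ j) := by
  classical
  intro hD
  -- Any `ε` below 1/2 would do: the fidelity is at most 1/2, while the protocol would reach 3/4.
  obtain ⟨N, Λ, hΛ⟩ := hD (1 / 4) (by norm_num)
  have hS : ∀ i, (∀ l ∈ (blockOf (⊥ : Finpartition (Finset.univ : Finset ι)) i).1, S l) ↔ S i := by
    intro i
    simp [blockOf_bot]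
  have hne : blockOf (⊥ : Finpartition (Finset.univ : Finset ι)) i ≠ blockOf ⊥ j := by
    intro heq
    have := congrArg Subtype.val heq
    rw [blockOf_bot, blockOf_bot, Finset.singleton_inj] at this
    exact hj (this ▸ hi)
  have h1 := Λ.posSemidef_run
    (fun T : {T // T ∈ (⊥ : Finpartition (Finset.univ : Finset ι)).parts} => ∀ l ∈ T.1, S l) _
    (posSemidef_copies hS h N)
  have h2 := bellFidelity_le_of_posSemidef hne _ ((hS i).2 hi) (fun h => hj ((hS j).1 h)) h1
  rw [Λ.trace_run, trace_copies, htr, one_pow, Complex.one_re] at h2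
  linarith

end Copies

/-! ### Entanglement of the joint eigenspaces -/

section Entanglement

variable {ι κ : Type} [Fintype ι] [DecidableEq ι] {d : ℕ}

theorem tensorOp_update_apply {H H' : ι → Type} (A : ∀ p, Matrix (H' p) (H p) ℂ)
    (x : ∀ p, H' p) (y : ∀ p, H p) (p : ι) (u : H' p) (v : H p) :
    tensorOp A (Function.update x p u) (Function.update y p v) =
      A p u v * ∏ q ∈ Finset.univ.erase p, A q (x q) (y q) := by
  rw [tensorOp, ← Finset.mul_prod_erase _ _ (Finset.mem_univ p), Function.update_self,
    Function.update_self]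
  congr 1
  refine Finset.prod_congr rfl fun q hq => ?_
  rw [Function.update_of_ne (Finset.ne_of_mem_erase hq),
    Function.update_of_ne (Finset.ne_of_mem_erase hq)]

/-- Proportional tensor products have proportional factors. -/
theorem factor_eq_smul_of_tensorOp_eq_smul {H H' : ι → Type} {A B : ∀ p, Matrix (H' p) (H p) ℂ}
    {c : ℂ} (hc : c ≠ 0) (hB : ∀ p, B p ≠ 0) (h : tensorOp A = c • tensorOp B) (p : ι) :
    ∃ r : ℂ, r ≠ 0 ∧ A p = r • B p := by
  have hex : ∀ p, ∃ u v, B p u v ≠ 0 := by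
    intro p
    by_contra! h0
    exact hB p (by ext u v; exact h0 u v)
  -- Fix a nonzero entry of every `B q`. Varying only the indices of the factor `p` then compares `A
  -- p` with `B p`, the other factors contributing constants.
  choose x y hxy using hex
  have hent : ∀ u v, A p u v * ∏ q ∈ Finset.univ.erase p, A q (x q) (y q) =
      c * (B p u v * ∏ q ∈ Finset.univ.erase p, B q (x q) (y q)) := by
    intro u v
    rw [← tensorOp_update_apply, ← tensorOp_update_apply, h]
    rfl
  have hβ : ∏ q ∈ Finset.univ.erase p, B q (x q) (y q) ≠ 0 :=
    Finset.prod_ne_zero_iff.2 fun q _ => hxy q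
  have hα : ∏ q ∈ Finset.univ.erase p, A q (x q) (y q) ≠ 0 := by
    intro h0
    have := hent (x p) (y p)
    rw [h0, mul_zero] at this
    exact mul_ne_zero hc (mul_ne_zero (hxy p) hβ) this.symm
  refine ⟨c * (∏ q ∈ Finset.univ.erase p, B q (x q) (y q)) /
    ∏ q ∈ Finset.univ.erase p, A q (x q) (y q), div_ne_zero (mul_ne_zero hc hβ) hα, ?_⟩
  ext u v
  rw [Matrix.smul_apply, smul_eq_mul, div_mul_eq_mul_div, eq_div_iff hα, hent]
  ring

theorem eq_of_mem_blockOf_bot {i l : ι}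
    (h : l ∈ (blockOf (⊥ : Finpartition (Finset.univ : Finset ι)) i).1) : l = i := by
  rwa [blockOf_bot, Finset.mem_singleton] at h

/-- A separable state is a convex combination of tensor products of single-qudit states. -/
theorem SeparableState.exists_tensorOp {ρ : Matrix (ι → Fin d) (ι → Fin d) ℂ}
    (h : SeparableState ρ ⊥) :
    ∃ (m : ℕ) (p : Fin m → ℝ) (σ : Fin m → ι → Matrix (Fin d) (Fin d) ℂ),
      (∀ s, 0 < p s) ∧ ∑ s, p s = 1 ∧ (∀ s i, (σ s i).PosSemidef ∧ σ s i ≠ 0) ∧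
      ρ = ∑ s, (p s : ℂ) • tensorOp (H := fun _ => Fin d) (H' := fun _ => Fin d) (σ s) := by
  obtain ⟨m, p, σ, hp, hsum, hσ, hρ⟩ := h
  have hconst : ∀ (i : ι) (x : ι → Fin d),
      (fun l : {l // l ∈ (blockOf (⊥ : Finpartition (Finset.univ : Finset ι)) i).1} => x l) =
        fun _ => x i := by
    intro i x
    funext l
    rw [eq_of_mem_blockOf_bot l.2]
  refine ⟨m, p, fun s i => (σ s (blockOf ⊥ i)).submatrix (fun u _ => u) (fun u _ => u), hp, hsum,
    fun s i => ⟨(hσ s _).1.submatrix _, fun h0 => ?_⟩, ?_⟩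
  · have htr := (hσ s (blockOf ⊥ i)).2
    have hz : σ s (blockOf ⊥ i) = 0 := by
      ext x y
      have hi : i ∈ (blockOf (⊥ : Finpartition (Finset.univ : Finset ι)) i).1 := mem_blockOf i
      have h1 : ∀ x : {l // l ∈ (blockOf (⊥ : Finpartition (Finset.univ : Finset ι)) i).1} → Fin d,
          x = fun _ => x ⟨i, hi⟩ := by
        intro x
        funext l
        exact congrArg x (Subtype.ext (eq_of_mem_blockOf_bot l.2))
      rw [h1 x, h1 y]
      exact congrFun (congrFun h0 (x ⟨i, hi⟩)) (y ⟨i, hi⟩)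
    rw [hz, Matrix.trace_zero] at htr
    exact zero_ne_one htr
  · ext x y
    rw [hρ, Matrix.sum_apply]
    refine Finset.sum_congr rfl fun s _ => ?_
    rw [Matrix.smul_apply, smul_eq_mul, tensorOp]
    congr 1
    symm
    refine Fintype.prod_bijective (blockOf ⊥) ⟨?_, ?_⟩ _ _ fun i => ?_
    · intro i j hij
      have := congrArg Subtype.val hij
      rwa [blockOf_bot, blockOf_bot, Finset.singleton_inj] at this
    · intro A
      obtain ⟨i, hi⟩ := exists_eq_blockOf_bot A
      exact ⟨i, hi.symm⟩
    · rw [hconst, hconst]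
      rfl

/-- Positive semidefinite summands inherit eigenvector relations from their sum. -/
theorem mul_eq_smul_of_sum {α : Type} [Fintype α] [DecidableEq α] {m : ℕ} {p : Fin m → ℝ}
    (hp : ∀ s, 0 < p s) {τ : Fin m → Matrix α α ℂ} (hτ : ∀ s, (τ s).PosSemidef)
    {G : Matrix α α ℂ} {μ : ℂ} (h : G * ∑ s, (p s : ℂ) • τ s = μ • ∑ s, (p s : ℂ) • τ s)
    (s : Fin m) : G * τ s = μ • τ s := by
  set ρ := ∑ s, (p s : ℂ) • τ s with hρ
  have hρH : ρ.conjTranspose = ρ := by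
    rw [hρ, Matrix.conjTranspose_sum]
    refine Finset.sum_congr rfl fun s _ => ?_
    rw [Matrix.conjTranspose_smul, (hτ s).isHermitian.eq, Complex.star_def, Complex.conj_ofReal]
  have h0 : ρ * (G - μ • 1).conjTranspose = 0 := by
    have h1 : (G - μ • 1) * ρ = 0 := by
      rw [Matrix.sub_mul, h, Matrix.smul_mul, Matrix.one_mul, sub_self]
    rw [← hρH, ← Matrix.conjTranspose_mul, h1, Matrix.conjTranspose_zero]
  -- The kernel of a positive combination lies in the kernel of each term: nonnegative expectation
  -- values summing to zero all vanish.
  have key : ∀ v : α → ℂ, ρ.mulVec v = 0 → (τ s).mulVec v = 0 := by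
    intro v hv
    rw [← (hτ s).dotProduct_mulVec_zero_iff]
    have hsum : ∑ s, (p s : ℂ) * (star v ⬝ᵥ (τ s).mulVec v) = 0 := by
      have := congrArg (fun w => star v ⬝ᵥ w) hv
      simpa only [hρ, Matrix.sum_mulVec, Matrix.smul_mulVec, dotProduct_sum, dotProduct_smul,
        smul_eq_mul, dotProduct_zero] using this
    have hnn : ∀ s ∈ Finset.univ, 0 ≤ (p s : ℂ) * (star v ⬝ᵥ (τ s).mulVec v) := fun s _ =>
      mul_nonneg (by exact_mod_cast (hp s).le) ((hτ s).dotProduct_mulVec_nonneg v)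
    have := (Finset.sum_eq_zero_iff_of_nonneg hnn).1 hsum s (Finset.mem_univ s)
    exact (mul_eq_zero.1 this).resolve_left (by exact_mod_cast (hp s).ne')
  -- The columns of `(G - μ • 1)ᴴ` lie in the kernel of `ρ`, hence in that of `τ s`; taking adjoints
  -- returns the eigenvector relation.
  have h2 : τ s * (G - μ • 1).conjTranspose = 0 := by
    ext x y
    have := key ((G - μ • 1).conjTranspose.col y) (by
      funext x
      exact congrFun (congrFun h0 x) y)
    exact congrFun this x
  have h3 : (G - μ • 1) * τ s = 0 := by
    rw [← Matrix.conjTranspose_conjTranspose (G - μ • 1), ← (hτ s).isHermitian.eq,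
      ← Matrix.conjTranspose_mul, h2, Matrix.conjTranspose_zero]
  rwa [Matrix.sub_mul, Matrix.smul_mul, Matrix.one_mul, sub_eq_zero] at h3

/-- A state supported on a joint eigenspace of two operators that do not commute on some qudit is
not fully separable. -/
theorem not_separableState [NeZero d] {g h : PauliElt ι d} {i : ι} (hgh : phase g h i ≠ 1)
    {ρ : Matrix (ι → Fin d) (ι → Fin d) ℂ} {μ ν : ℂ} (hμ : μ ≠ 0) (hν : ν ≠ 0)
    (hg : g.op * ρ = μ • ρ) (hh : h.op * ρ = ν • ρ) : ¬ SeparableState ρ ⊥ := by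
  intro hsep
  obtain ⟨m, p, σ, hp, hsum, hσ, rfl⟩ := hsep.exists_tensorOp
  obtain ⟨s⟩ : Nonempty (Fin m) := by
    by_contra h
    rw [not_nonempty_iff] at h
    simp at hsum
  have hτ := fun s => tensorOp_posSemidef (H := fun _ => Fin d) fun i => (hσ s i).1
  have h1 := mul_eq_smul_of_sum hp hτ hg s
  have h2 := mul_eq_smul_of_sum hp hτ hh s
  rw [op_eq_tensorOp, tensorOp_mul] at h1 h2
  obtain ⟨a, ha, h1⟩ := factor_eq_smul_of_tensorOp_eq_smul hμ (fun i => (hσ s i).2) h1 i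
  obtain ⟨b, hb, h2⟩ := factor_eq_smul_of_tensorOp_eq_smul hν (fun i => (hσ s i).2) h2 i
  -- Both orders of the two local operators act on the nonzero factor `σ s i` as the same nonzero
  -- scalar `a * b`, so the phase between them would have to be 1.
  have h3 : site g i * site h i * σ s i = (a * b) • σ s i := by
    rw [mul_assoc, h2, Matrix.mul_smul, h1, smul_smul, mul_comm]
  have h4 : site h i * site g i * σ s i = (a * b) • σ s i := by
    rw [mul_assoc, h1, Matrix.mul_smul, h2, smul_smul]
  rw [site_mul_site, Matrix.smul_mul, h4, smul_smul] at h3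
  have h5 : (phase g h i * (a * b) - a * b) • σ s i = 0 := by rw [sub_smul, h3, sub_self]
  have h6 := (smul_eq_zero.1 h5).resolve_right (hσ s i).2
  refine hgh (mul_right_cancel₀ (mul_ne_zero ha hb) ?_)
  rw [one_mul]
  exact sub_eq_zero.1 h6

/-- An inseparable stabilizer on several qudits contains generators that do not commute on some
qudit. -/
theorem exists_phase_ne_one [NeZero d] {g : κ → PauliElt ι d} {T : Finset ι} (hT : 1 < T.card)
    (h : StabInseparable fun j => (g j).restrict T) :
    ∃ i ∈ T, ∃ j l, phase (g j) (g l) i ≠ 1 := by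
  by_contra! hall
  refine h ⊥ ?_ ?_
  · intro hmem
    obtain ⟨a, -, ha⟩ := Finpartition.mem_bot_iff.1 hmem
    have := congrArg Finset.card ha
    rw [Finset.card_singleton, Finset.card_univ, Fintype.card_coe] at this
    omega
  · intro R _ j l
    rw [commute_restrict_iff]
    exact Finset.prod_eq_one fun i _ => hall i i.2 j l

end Entanglement

/-! ### Local operators of single parties -/

section Local

variable {P : Type} [Fintype P] [DecidableEq P] {H : P → Type} [∀ p, Fintype (H p)]
  [∀ p, DecidableEq (H p)]

theorem tensorOp_update_one_apply (A : P) (M : Matrix (H A) (H A) ℂ) (x y : ∀ p, H p) :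
    tensorOp (Function.update (fun p => (1 : Matrix (H p) (H p) ℂ)) A M) x y =
      M (x A) (y A) * ∏ p ∈ Finset.univ.erase A, (1 : Matrix (H p) (H p) ℂ) (x p) (y p) := by
  rw [tensorOp, ← Finset.mul_prod_erase _ _ (Finset.mem_univ A), Function.update_self]
  congr 1
  exact Finset.prod_congr rfl fun q hq => by rw [Function.update_of_ne (Finset.ne_of_mem_erase hq)]

/-- The operator that acts as `M` on the system of `A` and trivially elsewhere. -/
def loc (A : P) : Matrix (H A) (H A) ℂ →ₐ[ℂ] Matrix (∀ p, H p) (∀ p, H p) ℂ :=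
  AlgHom.ofLinearMap
    { toFun := fun M => tensorOp (Function.update (fun p => (1 : Matrix (H p) (H p) ℂ)) A M)
      map_add' := fun M N => by
        ext x y
        simp only [Matrix.add_apply, tensorOp_update_one_apply, add_mul]
      map_smul' := fun c M => by
        ext x y
        simp only [Matrix.smul_apply, tensorOp_update_one_apply, smul_eq_mul, mul_assoc,
          RingHom.id_apply] }
    (by
      change tensorOp (Function.update (fun p => (1 : Matrix (H p) (H p) ℂ)) A 1) = 1
      rw [Function.update_eq_self A (fun p => (1 : Matrix (H p) (H p) ℂ)), tensorOp_one])
    (fun M N => by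
      change tensorOp (Function.update (fun p => (1 : Matrix (H p) (H p) ℂ)) A (M * N)) =
        tensorOp (Function.update (fun p => (1 : Matrix (H p) (H p) ℂ)) A M) *
        tensorOp (Function.update (fun p => (1 : Matrix (H p) (H p) ℂ)) A N)
      rw [tensorOp_mul]
      congr 1
      funext p
      by_cases h : p = A
      · subst h
        simp
      · simp [h])

theorem loc_apply (A : P) (M : Matrix (H A) (H A) ℂ) :
    loc A M = tensorOp (Function.update (fun p => (1 : Matrix (H p) (H p) ℂ)) A M) := rfl

theorem loc_conjTranspose (A : P) (M : Matrix (H A) (H A) ℂ) :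
    (loc A M).conjTranspose = loc A M.conjTranspose := by
  rw [loc_apply, loc_apply, tensorOp_conjTranspose]
  congr 1
  funext p
  by_cases h : p = A
  · subst h
    simp
  · simp [h]

theorem loc_mul_loc {A B : P} (hAB : A ≠ B) (M : Matrix (H A) (H A) ℂ)
    (N : Matrix (H B) (H B) ℂ) :
    loc A M * loc B N =
      tensorOp (Function.update (Function.update (fun p => (1 : Matrix (H p) (H p) ℂ)) A M) B N)
    ∧ loc B N * loc A M = tensorOp
      (Function.update (Function.update (fun p => (1 : Matrix (H p) (H p) ℂ)) A M) B N) := by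
  rw [loc_apply, loc_apply, tensorOp_mul, tensorOp_mul]
  constructor
  all_goals
    congr 1
    funext p
    by_cases hB : p = B
    · subst hB
      simp [Function.update_of_ne hAB.symm]
    by_cases hA : p = A
    · subst hA
      simp [Function.update_of_ne hAB]
    · simp [hA, hB]

theorem loc_commute {A B : P} (hAB : A ≠ B) (M : Matrix (H A) (H A) ℂ)
    (N : Matrix (H B) (H B) ℂ) : Commute (loc A M) (loc B N) :=
  (loc_mul_loc hAB M N).1.trans (loc_mul_loc hAB M N).2.symm

theorem tensorOp_eq_loc_mul_loc {A B : P} (hAB : A ≠ B) (hall : ∀ p, p = A ∨ p = B)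
    (Q : ∀ p, Matrix (H p) (H p) ℂ) : tensorOp Q = loc A (Q A) * loc B (Q B) := by
  rw [(loc_mul_loc hAB _ _).1]
  congr 1
  funext p
  rcases hall p with rfl | rfl
  · simp [Function.update_of_ne hAB]
  · simp

theorem loc_mem_unitaryGroup (A : P) {U : Matrix (H A) (H A) ℂ}
    (hU : U ∈ Matrix.unitaryGroup (H A) ℂ) : loc A U ∈ Matrix.unitaryGroup (∀ p, H p) ℂ := by
  rw [Matrix.mem_unitaryGroup_iff', Matrix.star_eq_conjTranspose, loc_conjTranspose, ← map_mul,
    ← Matrix.star_eq_conjTranspose, Matrix.mem_unitaryGroup_iff'.1 hU, map_one]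

theorem loc_eigProj (A : P) (d : ℕ) (c : ℂ) (V : Matrix (H A) (H A) ℂ) :
    loc A (eigProj d c V) = eigProj d c (loc A V) := by
  simp only [eigProj, avg, map_smul, map_sum, map_pow]

end Local

/-! ### A protocol for two parties -/

section Protocol

/-- Measurement operators that distinguish the ranges of `E₀` and `E₁` from their complement, and
return the qubit in the span of `E₀` and `U⋆ E₁`. -/
def qubitKraus {α : Type} [Fintype α] [DecidableEq α] (E₀ E₁ U : Matrix α α ℂ)
    (t r : Fin 2) : Matrix α α ℂ :=
  if t = 0 then (if r = 0 then E₀ else star U * E₁) else if r = 0 then 1 - E₀ - E₁ else 0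

theorem qubitKraus_complete {α : Type} [Fintype α] [DecidableEq α] {E₀ E₁ U : Matrix α α ℂ}
    (h₀ : IsStarProjection E₀) (h₁ : IsStarProjection E₁) (h : E₀ * E₁ = 0)
    (hU : U ∈ Matrix.unitaryGroup α ℂ) :
    ∑ t, ∑ r, star (qubitKraus E₀ E₁ U t r) * qubitKraus E₀ E₁ U t r = 1 := by
  have h' : E₁ * E₀ = 0 := by
    have := congrArg star h
    rwa [star_mul, h₀.isSelfAdjoint.star_eq, h₁.isSelfAdjoint.star_eq, star_zero] at this
  have h2 : star (star U * E₁) * (star U * E₁) = E₁ := by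
    rw [star_mul, star_star, mul_assoc, ← mul_assoc U, Matrix.mem_unitaryGroup_iff.1 hU, one_mul,
      h₁.isSelfAdjoint.star_eq, h₁.isIdempotentElem.eq]
  have h3 : star (1 - E₀ - E₁) * (1 - E₀ - E₁) = 1 - E₀ - E₁ := by
    rw [star_sub, star_sub, star_one, h₀.isSelfAdjoint.star_eq, h₁.isSelfAdjoint.star_eq]
    simp only [mul_sub, sub_mul, one_mul, mul_one, h, h', h₀.isIdempotentElem.eq,
      h₁.isIdempotentElem.eq]
    abel
  simp only [Fin.sum_univ_two, qubitKraus, if_true, one_ne_zero, if_false, h2, h3,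
    h₀.isSelfAdjoint.star_eq, h₀.isIdempotentElem.eq, star_zero, zero_mul]
  abel

/-- The instrument that applies the operators `F t r` coherently in `r`, keeps the qubit `r`, and
measures the remaining system in the standard basis. -/
def readout {α : Type} [Fintype α] [DecidableEq α] (F : Fin 2 → Fin 2 → Matrix α α ℂ)
    (hF : ∑ t, ∑ r, star (F t r) * F t r = 1) : Instrument α (Fin 2) where
  m := Fintype.card (Fin 2 × α)
  K s := Matrix.of fun r y => F ((Fintype.equivFin (Fin 2 × α)).symm s).1 r
    ((Fintype.equivFin (Fin 2 × α)).symm s).2 y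
  complete := by
    rw [← hF, Equiv.sum_comp (Fintype.equivFin (Fin 2 × α)).symm fun s : Fin 2 × α =>
      (Matrix.of fun r y => F s.1 r s.2 y).conjTranspose * Matrix.of fun r y => F s.1 r s.2 y,
      Fintype.sum_prod_type]
    refine Finset.sum_congr rfl fun t _ => ?_
    ext x y
    simp only [Matrix.sum_apply, Matrix.mul_apply, Matrix.conjTranspose_apply, Matrix.of_apply,
      Matrix.star_apply]
    exact Finset.sum_comm

variable {d : ℕ} [NeZero d]

theorem eigProj_mul_eigProj_eq_zero {α : Type} [Fintype α] [DecidableEq α] {V : Matrix α α ℂ}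
    {b c : ℂ} (hV : V ^ d = 1) (hb : b ^ d = 1) (hc : c ^ d = 1) (hbc : b ≠ c) :
    eigProj d c V * eigProj d b V = 0 :=
  eigProj_mul_eq_zero hc hb hbc (mul_eigProj hb hV)

theorem sum_eigProj_mul {α : Type} [Fintype α] [DecidableEq α] (V : Matrix α α ℂ) (τ : ℂ) :
    ∑ x : Fin d, eigProj d (τ * omega d ^ (x : ℕ)) V = 1 := by
  rw [← sum_eigProj (d := d) (τ⁻¹ • V)]
  refine Finset.sum_congr rfl fun x _ => ?_
  rw [eigProj, eigProj, smul_smul, mul_inv, mul_comm]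

theorem sq_inv_sqrt (m : ℕ) :
    star (((Real.sqrt m)⁻¹ : ℝ) : ℂ) * (((Real.sqrt m)⁻¹ : ℝ) : ℂ) = (m : ℂ)⁻¹ := by
  rw [Complex.star_def, Complex.conj_ofReal, ← Complex.ofReal_mul, ← mul_inv,
    Real.mul_self_sqrt (Nat.cast_nonneg m)]
  simp

/-- As `x` varies, each eigenvalue is met twice, once as `omega d ^ x` and once as `τ * omega d ^
x`; the weight `1 / √2` compensates for this. Since `τ ≠ 1`, the two projections in a pair are
orthogonal. -/
theorem sum_pairMeasurement {α : Type} [Fintype α] [DecidableEq α] {V : Matrix α α ℂ}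
    (hV : V ^ d = 1) (hVu : V ∈ Matrix.unitaryGroup α ℂ) {τ : ℂ} (hτ : τ ^ d = 1) (hτ1 : τ ≠ 1) :
    ∑ x : Fin d, ((((Real.sqrt (2 : ℕ))⁻¹ : ℝ) : ℂ) • (eigProj d (omega d ^ (x : ℕ)) V +
        eigProj d (τ * omega d ^ (x : ℕ)) V)).conjTranspose *
      ((((Real.sqrt (2 : ℕ))⁻¹ : ℝ) : ℂ) • (eigProj d (omega d ^ (x : ℕ)) V +
        eigProj d (τ * omega d ^ (x : ℕ)) V)) = 1 := by
  have hw : ∀ x : ℕ, (omega d ^ x) ^ d = 1 := fun x => by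
    rw [← pow_mul, mul_comm, pow_mul, (omega_primitive d).pow_eq_one, one_pow]
  have hτw : ∀ x : ℕ, (τ * omega d ^ x) ^ d = 1 := fun x => by rw [mul_pow, hτ, hw, one_mul]
  have hne : ∀ x : ℕ, omega d ^ x ≠ τ * omega d ^ x := by
    intro x h
    exact hτ1 (mul_right_cancel₀ (pow_ne_zero x (omega_ne_zero d)) (by rw [← h, one_mul]))
  have hterm : ∀ x : Fin d, ((((Real.sqrt (2 : ℕ))⁻¹ : ℝ) : ℂ) • (eigProj d (omega d ^ (x : ℕ)) V +
        eigProj d (τ * omega d ^ (x : ℕ)) V)).conjTranspose *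
      ((((Real.sqrt (2 : ℕ))⁻¹ : ℝ) : ℂ) • (eigProj d (omega d ^ (x : ℕ)) V +
        eigProj d (τ * omega d ^ (x : ℕ)) V)) =
      ((2 : ℕ) : ℂ)⁻¹ • (eigProj d (omega d ^ (x : ℕ)) V +
        eigProj d (τ * omega d ^ (x : ℕ)) V) := by
    intro x
    have h0 := eigProj_isStarProjection (hw x) hV hVu
    have h1 := eigProj_isStarProjection (hτw x) hV hVu
    rw [Matrix.conjTranspose_smul, Matrix.smul_mul, Matrix.mul_smul, smul_smul, sq_inv_sqrt,
      ← Matrix.star_eq_conjTranspose, star_add, h0.isSelfAdjoint.star_eq,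
      h1.isSelfAdjoint.star_eq, add_mul, mul_add, mul_add, h0.isIdempotentElem.eq,
      h1.isIdempotentElem.eq, eigProj_mul_eigProj_eq_zero hV (hw x) (hτw x) (hne x),
      eigProj_mul_eigProj_eq_zero hV (hτw x) (hw x) (hne x).symm, add_zero, zero_add]
  simp only [hterm]
  rw [← Finset.smul_sum, Finset.sum_add_distrib, sum_eigProj, sum_eigProj_mul, ← two_smul ℂ,
    smul_smul]
  norm_num

/-- Joint eigenvectors of `va * vb` and `a * b`, where `va`, `a` belong to one party and `vb`, `b`
to another, and `va` and `a` commute up to the phase `τ`: measuring eigenvalues of `va` and `vb`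
gives correlated results, and the eigenvectors for the eigenvalues `c` and `τ * c` are related by
local operations. -/
theorem correlations {α β : Type} [Fintype α] [DecidableEq α] {a b va vb : Matrix α α ℂ}
    {Ψ : Matrix α β ℂ} {μ ν τ c : ℂ} (hab : Commute a b)
    (hvab : Commute va b) (hvavb : Commute va vb)
    (ha : a ∈ Matrix.unitaryGroup α ℂ) (hb : b ∈ Matrix.unitaryGroup α ℂ) (hva : va ^ d = 1)
    (hτ : τ ^ d = 1) (hτ1 : τ ≠ 1) (hc : c ^ d = 1) (hν : ν ^ d = 1) (hμ : μ ^ d = 1)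
    (h : va * a = τ • (a * va)) (hΨ : a * b * Ψ = μ • Ψ) (hΨ' : va * vb * Ψ = ν • Ψ) :
    (eigProj d (ν * c⁻¹) vb * (eigProj d c va * Ψ) = eigProj d c va * Ψ ∧
      eigProj d (ν * (τ * c)⁻¹) vb * (eigProj d c va * Ψ) = 0) ∧
    (eigProj d (ν * c⁻¹) vb * (eigProj d (τ * c) va * Ψ) = 0 ∧
      eigProj d (ν * (τ * c)⁻¹) vb * (eigProj d (τ * c) va * Ψ) = eigProj d (τ * c) va * Ψ) ∧
    μ • (star a * star b * (eigProj d (τ * c) va * Ψ)) = eigProj d c va * Ψ := by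
  have hτ0 := ne_zero_of_pow_eq_one hτ
  have hν0 := ne_zero_of_pow_eq_one hν
  have hμ0 := ne_zero_of_pow_eq_one hμ
  have hc0 := ne_zero_of_pow_eq_one hc
  have hcτ : (τ * c) ^ d = 1 := by rw [mul_pow, hτ, hc, one_mul]
  have hr : ∀ x : ℂ, x ^ d = 1 → (ν * x⁻¹) ^ d = 1 := fun x hx => by
    rw [mul_pow, inv_pow, hν, hx, inv_one, one_mul]
  have hcomm : ∀ (x : ℂ) {y : Matrix α α ℂ}, Commute va y →
      eigProj d x va * y = y * eigProj d x va := by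
    intro x y hy
    refine avg_semiconj ?_
    rw [Matrix.smul_mul, Matrix.mul_smul, hy.eq]
  -- Since `va * vb` acts on `Ψ` as `ν`, the outcome `x` for `va` leaves an eigenvector of `vb` with
  -- eigenvalue `ν * x⁻¹`.
  have heig : ∀ x : ℂ, x ^ d = 1 →
      vb * (eigProj d x va * Ψ) = (ν * x⁻¹) • (eigProj d x va * Ψ) := by
    intro x hx
    have h1 : va * (vb * (eigProj d x va * Ψ)) = ν • (eigProj d x va * Ψ) := by
      have h2 : va * vb * eigProj d x va = eigProj d x va * (va * vb) :=
        (hcomm x ((Commute.refl va).mul_right hvavb)).symm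
      rw [← Matrix.mul_assoc, ← Matrix.mul_assoc, h2, Matrix.mul_assoc, hΨ', Matrix.mul_smul]
    have h3 : va * (vb * (eigProj d x va * Ψ)) = x • (vb * (eigProj d x va * Ψ)) := by
      rw [← Matrix.mul_assoc, hvavb.eq, Matrix.mul_assoc, ← Matrix.mul_assoc va,
        mul_eigProj hx hva, Matrix.smul_mul, Matrix.mul_smul]
    rw [h3] at h1
    rw [mul_comm, mul_smul, ← h1, inv_smul_smul₀ (ne_zero_of_pow_eq_one hx)]
  have hne : ν * c⁻¹ ≠ ν * (τ * c)⁻¹ := by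
    intro h0
    have h1 := inv_injective (mul_left_cancel₀ hν0 h0)
    exact hτ1 (mul_right_cancel₀ hc0 (by rw [← h1, one_mul]))
  refine ⟨⟨eigProj_mul_of_eigen (hr c hc) (heig c hc),
    eigProj_mul_eq_zero (hr _ hcτ) (hr c hc) hne (heig c hc)⟩,
    ⟨eigProj_mul_eq_zero (hr c hc) (hr _ hcτ) hne.symm (heig _ hcτ),
      eigProj_mul_of_eigen (hr _ hcτ) (heig _ hcτ)⟩, ?_⟩
  -- `a` carries the `c`-eigenspace of `va` to the `τ * c`-eigenspace, and `b` does not disturb it.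
  -- So `a * b` relates the two components of its eigenvector `Ψ`.
  have h1 : eigProj d (τ * c) va * (a * b) = a * b * eigProj d c va := by
    rw [← mul_assoc, eigProj_mul_of_comm hτ0 h, mul_assoc, hcomm c hvab, mul_assoc]
  have h2 : μ • (eigProj d (τ * c) va * Ψ) = a * b * (eigProj d c va * Ψ) := by
    rw [← Matrix.mul_smul, ← hΨ, ← Matrix.mul_assoc, h1, Matrix.mul_assoc]
  rw [← Matrix.mul_smul, h2, hab.eq, ← Matrix.mul_assoc, mul_assoc (star a), ← mul_assoc (star b),
    Matrix.mem_unitaryGroup_iff'.1 hb, one_mul, Matrix.mem_unitaryGroup_iff'.1 ha, Matrix.one_mul]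

/-- States of qubits that are multiples of the Bell state of `A` and `B`. -/
def IsBell {P : Type} (A B : P) (σ : Matrix (P → Fin 2) (P → Fin 2) ℂ) : Prop :=
  ∃ c : ℂ, ∀ x y, σ x y = if x A = x B ∧ y A = y B then c else 0

theorem IsBell.sum {P τ : Type} {A B : P} (s : Finset τ)
    {σ : τ → Matrix (P → Fin 2) (P → Fin 2) ℂ} (h : ∀ t ∈ s, IsBell A B (σ t)) :
    IsBell A B (∑ t ∈ s, σ t) := by
  choose! c hc using h
  refine ⟨∑ t ∈ s, c t, fun x y => ?_⟩
  rw [Matrix.sum_apply, Finset.sum_congr rfl fun t ht => hc t ht x y]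
  split_ifs <;> simp

theorem IsBell.bellFidelity_eq_one {P : Type} [Fintype P] [DecidableEq P] {A B : P} (hAB : A ≠ B)
    (hall : ∀ p, p = A ∨ p = B) {σ : Matrix (P → Fin 2) (P → Fin 2) ℂ} (h : IsBell A B σ)
    (htr : σ.trace = 1) : bellFidelity (pairState σ A B) = 1 := by
  obtain ⟨c, hc⟩ := h
  have hfilter : (Finset.univ.filter fun z : P → Fin 2 => z A = 0 ∧ z B = 0) = {0} := by
    ext z
    simp only [Finset.mem_filter, Finset.mem_univ, true_and, Finset.mem_singleton]
    constructor
    · rintro ⟨hA, hB⟩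
      funext p
      rcases hall p with rfl | rfl
      · exact hA
      · exact hB
    · rintro rfl
      simp
  have hA : ∀ z r s, setPair A B z r s A = r := fun z r s => by simp [setPair, hAB]
  have hB : ∀ z r s, setPair A B z r s B = s := fun z r s => by simp [setPair]
  rw [trace_eq_sum_setPair hAB, hfilter, Finset.sum_singleton] at htr
  simp only [hc, hA, hB, Fin.sum_univ_two, and_self, if_true, zero_ne_one, one_ne_zero, if_false,
    add_zero, zero_add] at htr
  have hp : ∀ r s, pairState σ A B (r, r) (s, s) = c := by
    intro r s
    rw [pairState, hfilter, Finset.sum_singleton]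
    change σ (setPair A B 0 r r) (setPair A B 0 s s) = c
    rw [hc, hA, hA, hB, hB, if_pos ⟨rfl, rfl⟩]
  simp only [bellFidelity, hp, Fin.sum_univ_two]
  rw [htr]
  norm_num

end Protocol

/-! ### The two-round protocol that yields a Bell state. -/

section TwoRounds

variable {P : Type} [Fintype P] [DecidableEq P] {H : P → Type} [∀ p, Fintype (H p)]
  [∀ p, DecidableEq (H p)] {A B : P} {β : Type}

/-- The total Kraus operator sends each column of `Ψ` to a multiple of the sum of all basis vectors
on which the qubits of `A` and `B` agree; summing over columns changes only the scalar. -/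
theorem isBell_of_mul_apply [Fintype β] {T : Matrix (P → Fin 2) (∀ p, H p) ℂ}
    {Ψ : Matrix (∀ p, H p) β ℂ}
    {D : β → ℂ} (h : ∀ x y, (T * Ψ) x y = if x A = x B then D y else 0) (c : ℂ) :
    IsBell A B (T * (c • (Ψ * Ψ.conjTranspose)) * T.conjTranspose) := by
  refine ⟨c * ∑ y, D y * star (D y), fun x x' => ?_⟩
  have h1 : T * (c • (Ψ * Ψ.conjTranspose)) * T.conjTranspose =
      c • ((T * Ψ) * (T * Ψ).conjTranspose) := by
    rw [Matrix.mul_smul, Matrix.smul_mul, Matrix.conjTranspose_mul]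
    simp only [Matrix.mul_assoc]
  rw [h1, Matrix.smul_apply, Matrix.mul_apply, smul_eq_mul]
  simp only [Matrix.conjTranspose_apply, h]
  by_cases hx : x A = x B <;> by_cases hx' : x' A = x' B <;> simp [hx, hx']

/-- After correlated measurements on `A` and `B` the qubits read out by the two parties agree
coherently. -/
theorem readout_correlated (hAB : A ≠ B) {E₀ E₁ UA : Matrix (H A) (H A) ℂ}
    {G₀ G₁ UB : Matrix (H B) (H B) ℂ} {Ψ : Matrix (∀ p, H p) β ℂ}
    (hE₀ : E₀ * E₀ = E₀) (hE₁ : E₁ * E₁ = E₁) (hE : E₀ * E₁ = 0) (hE' : E₁ * E₀ = 0)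
    (h00 : loc B G₀ * (loc A E₀ * Ψ) = loc A E₀ * Ψ) (h10 : loc B G₁ * (loc A E₀ * Ψ) = 0)
    (h01 : loc B G₀ * (loc A E₁ * Ψ) = 0) (h11 : loc B G₁ * (loc A E₁ * Ψ) = loc A E₁ * Ψ)
    (hU : loc A (star UA) * (loc B (star UB) * (loc A E₁ * Ψ)) = loc A E₀ * Ψ)
    (k l : ℂ) (t u : Fin 2) :
    ∃ D : Matrix (∀ p, H p) β ℂ, ∀ r s,
      loc A (qubitKraus E₀ E₁ UA t r * k • (E₀ + E₁)) *
        loc B (qubitKraus G₀ G₁ UB u s * l • (1 : Matrix (H B) (H B) ℂ)) * Ψ =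
      if r = s then D else 0 := by
  have hmain : ∀ r, qubitKraus E₀ E₁ UA 0 r * k • (E₀ + E₁) =
      k • (if r = 0 then E₀ else star UA * E₁) := by
    intro r
    simp only [qubitKraus, if_true]
    split_ifs
    · rw [Matrix.mul_smul, mul_add, hE₀, hE, add_zero]
    · rw [Matrix.mul_smul, mul_assoc, mul_add, hE₁, hE', zero_add]
  -- The failure branch of `A` has no weight: the first round already projected onto the ranges of
  -- `E₀` and `E₁`.
  have hrest : ∀ r, qubitKraus E₀ E₁ UA 1 r * k • (E₀ + E₁) = 0 := by
    intro r
    simp only [qubitKraus, one_ne_zero, if_false]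
    split_ifs
    · rw [Matrix.mul_smul, mul_add, sub_mul, sub_mul, sub_mul, sub_mul, one_mul, one_mul, hE₀, hE₁,
        hE, hE']
      simp
    · rw [zero_mul]
  have hswap : ∀ (X : Matrix (H A) (H A) ℂ) (Y : Matrix (H B) (H B) ℂ),
      loc A X * loc B Y * Ψ = loc B Y * (loc A X * Ψ) := by
    intro X Y
    rw [(loc_commute hAB X Y).eq, Matrix.mul_assoc]
  have hswap' : ∀ (X X' : Matrix (H A) (H A) ℂ) (Y : Matrix (H B) (H B) ℂ),
      loc A (X * X') * loc B Y * Ψ = loc A X * (loc B Y * (loc A X' * Ψ)) := by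
    intro X X' Y
    rw [map_mul, mul_assoc, Matrix.mul_assoc, hswap]
  have hc : ∀ (X : Matrix (H A) (H A) ℂ) (Y : Matrix (H B) (H B) ℂ),
      loc A (k • X) * loc B (Y * l • (1 : Matrix (H B) (H B) ℂ)) * Ψ =
        (k * l) • (loc A X * loc B Y * Ψ) := by
    intro X Y
    rw [Matrix.mul_smul, mul_one, map_smul, map_smul, Matrix.smul_mul, Matrix.mul_smul, smul_smul,
      Matrix.smul_mul]
  obtain rfl | rfl : t = 1 ∨ t = 0 := by omega
  · refine ⟨0, fun r s => ?_⟩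
    rw [hrest, map_zero, Matrix.zero_mul, Matrix.zero_mul, ite_self]
  simp only [hmain, hc]
  obtain rfl | rfl : u = 0 ∨ u = 1 := by omega
  · refine ⟨(k * l) • (loc A E₀ * Ψ), fun r s => ?_⟩
    obtain rfl | rfl : r = 0 ∨ r = 1 := by omega
    · obtain rfl | rfl : s = 0 ∨ s = 1 := by omega
      · simp only [qubitKraus, if_true, hswap, h00]
      · simp only [qubitKraus, if_true, zero_ne_one, one_ne_zero, if_false]
        rw [hswap, map_mul, Matrix.mul_assoc, h10, Matrix.mul_zero, smul_zero]
    · obtain rfl | rfl : s = 0 ∨ s = 1 := by omega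
      · simp only [qubitKraus, if_true, one_ne_zero, if_false, hswap', h01, Matrix.mul_zero,
          smul_zero]
      · simp only [qubitKraus, if_true, one_ne_zero, if_false, hswap']
        rw [map_mul, Matrix.mul_assoc, h11, hU]
  · refine ⟨0, fun r s => ?_⟩
    -- `B` cannot fail either, since `G₀` and `G₁` together fix both components of the state.
    have hz : ∀ r, loc B (1 - G₀ - G₁) * (loc A (if r = (0 : Fin 2) then E₀ else E₁) * Ψ) = 0 := by
      intro r
      rw [map_sub, map_sub, map_one, Matrix.sub_mul, Matrix.sub_mul, Matrix.one_mul]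
      split_ifs
      · rw [h00, h10, sub_self, sub_zero]
      · rw [h01, h11, sub_zero, sub_self]
    obtain rfl | rfl : s = 1 ∨ s = 0 := by omega
    · simp [qubitKraus]
    · obtain rfl | rfl : r = 0 ∨ r = 1 := by omega
      · have := hz 0
        simp only [if_true] at this
        simp only [qubitKraus, one_ne_zero, if_false, if_true, hswap, this, smul_zero]
      · have := hz 1
        simp only [one_ne_zero, if_false] at this
        simp only [qubitKraus, one_ne_zero, if_false, if_true, hswap', this, Matrix.mul_zero,
          smul_zero]

variable {d : ℕ} [NeZero d] {U V : ∀ p, Matrix (H p) (H p) ℂ} {μ ν τ : ℂ}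

theorem omega_pow_pow_dim (x : ℕ) : (omega d ^ x) ^ d = 1 := by
  rw [← pow_mul, mul_comm, pow_mul, (omega_primitive d).pow_eq_one, one_pow]

/-- The first round: `A` measures pairs of eigenvalues of `V A`. -/
def pairRound (A : P) (hV : ∀ p, V p ∈ Matrix.unitaryGroup (H p) ℂ) (hVd : ∀ p, V p ^ d = 1)
    (hτ : τ ^ d = 1) (hτ1 : τ ≠ 1) (p : P) : Instrument (H p) (H p) where
  m := d
  K x := if p = A then (((Real.sqrt (2 : ℕ))⁻¹ : ℝ) : ℂ) •
      (eigProj d (omega d ^ (x : ℕ)) (V p) + eigProj d (τ * omega d ^ (x : ℕ)) (V p))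
    -- Every other party leaves its system alone and draws a uniform outcome, so that all parties
    -- have `d` outcomes.
    else (((Real.sqrt d)⁻¹ : ℝ) : ℂ) • 1
  complete := by
    by_cases h : p = A
    · simp only [if_pos h]
      exact sum_pairMeasurement (hVd p) (hV p) hτ hτ1
    · have hd : (d : ℂ) ≠ 0 := Nat.cast_ne_zero.2 (NeZero.ne d)
      have hk := sq_inv_sqrt d
      rw [mul_comm] at hk
      simp only [if_neg h, Matrix.conjTranspose_smul, Matrix.conjTranspose_one,
        Matrix.mul_smul, smul_smul, mul_one, hk, Finset.sum_const, Finset.card_univ,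
        Fintype.card_fin, ← Nat.cast_smul_eq_nsmul ℂ, mul_inv_cancel₀ hd, one_smul]

/-- The eigenvalue of `V p` in the second round that corresponds to the eigenvalue `c` at `A`. -/
def partnerValue (A : P) (ν c : ℂ) (p : P) : ℂ := if p = A then c else ν * c⁻¹

theorem partnerValue_pow (hν : ν ^ d = 1) {c : ℂ} (hc : c ^ d = 1) (p : P) :
    partnerValue A ν c p ^ d = 1 := by
  rw [partnerValue]
  split_ifs
  · exact hc
  · rw [mul_pow, inv_pow, hν, hc, inv_one, one_mul]

theorem partnerValue_ne (hν : ν ^ d = 1) {b c : ℂ} (hbc : b ≠ c) (p : P) :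
    partnerValue A ν b p ≠ partnerValue A ν c p := by
  simp only [partnerValue]
  split_ifs
  · exact hbc
  · exact fun h => hbc (inv_injective (mul_left_cancel₀ (ne_zero_of_pow_eq_one hν) h))

/-- The measurement operators of the second round. -/
def readKraus (A : P) (U V : ∀ p, Matrix (H p) (H p) ℂ) (d : ℕ) (μ ν τ c : ℂ) (p : P) :
    Fin 2 → Fin 2 → Matrix (H p) (H p) ℂ :=
  qubitKraus (eigProj d (partnerValue A ν c p) (V p)) (eigProj d (partnerValue A ν (τ * c) p) (V p))
    ((if p = A then 1 else μ⁻¹) • U p)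

theorem readKraus_complete (hU : ∀ p, U p ∈ Matrix.unitaryGroup (H p) ℂ)
    (hV : ∀ p, V p ∈ Matrix.unitaryGroup (H p) ℂ) (hVd : ∀ p, V p ^ d = 1) (hτ : τ ^ d = 1)
    (hτ1 : τ ≠ 1) (hμ : μ ^ d = 1) (hν : ν ^ d = 1) {c : ℂ} (hc : c ^ d = 1) (p : P) :
    ∑ t, ∑ r, star (readKraus A U V d μ ν τ c p t r) * readKraus A U V d μ ν τ c p t r = 1 := by
  have hcτ : (τ * c) ^ d = 1 := by rw [mul_pow, hτ, hc, one_mul]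
  have hne : τ * c ≠ c := fun h =>
    hτ1 (mul_right_cancel₀ (ne_zero_of_pow_eq_one hc) (by rw [h, one_mul]))
  have h1 := partnerValue_pow (A := A) hν hc p
  have h2 := partnerValue_pow (A := A) hν hcτ p
  refine qubitKraus_complete (eigProj_isStarProjection h1 (hVd p) (hV p))
    (eigProj_isStarProjection h2 (hVd p) (hV p))
    (eigProj_mul_eigProj_eq_zero (hVd p) h2 h1 (partnerValue_ne hν hne p))
    (smul_mem_unitaryGroup (d := d) ?_ (hU p))
  split_ifs
  · rw [one_pow]
  · rw [inv_pow, hμ, inv_one]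

/-- Two parties that share joint eigenvectors of the products of local unitaries `U`, `V` of order
`d`, which commute locally only up to a nontrivial phase, can produce a Bell state. -/
theorem exists_bell_protocol [Fintype β] (hAB : A ≠ B) (hall : ∀ p, p = A ∨ p = B)
    (hU : ∀ p, U p ∈ Matrix.unitaryGroup (H p) ℂ) (hV : ∀ p, V p ∈ Matrix.unitaryGroup (H p) ℂ)
    (hVd : ∀ p, V p ^ d = 1) (hτ : τ ^ d = 1) (hτ1 : τ ≠ 1) (hμ : μ ^ d = 1) (hν : ν ^ d = 1)
    (h : V A * U A = τ • (U A * V A)) {Ψ : Matrix (∀ p, H p) β ℂ}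
    (hΨ : tensorOp U * Ψ = μ • Ψ) (hΨ' : tensorOp V * Ψ = ν • Ψ) :
    ∃ Λ : LOCC (fun _ : P => Fin 2) H,
      ∀ c : ℂ, IsBell A B (Λ.run (c • (Ψ * Ψ.conjTranspose))) := by
  have hw : ∀ x : Fin d, (omega d ^ (x : ℕ)) ^ d = 1 := fun x => omega_pow_pow_dim x
  have hread := fun x : Fin d => readKraus_complete (A := A) hU hV hVd hτ hτ1 hμ hν (hw x)
  -- The outcome `s A` of the first round is broadcast, and it alone fixes the pair of sectors that
  -- all parties read out.
  refine ⟨LOCC.round (pairRound A hV hVd hτ hτ1) fun s => LOCC.round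
    (fun p => readout (readKraus A U V d μ ν τ (omega d ^ ((show Fin d from s A) : ℕ)) p)
      (hread (s A) p)) fun _ => LOCC.done, fun c => ?_⟩
  simp only [LOCC.run]
  refine IsBell.sum _ fun s _ => IsBell.sum _ fun t _ => ?_
  obtain ⟨x, hx⟩ : ∃ x : Fin d, x = s A := ⟨s A, rfl⟩
  rw [tensorOp_eq_loc_mul_loc hAB hall] at hΨ hΨ'
  have hcτ : (τ * omega d ^ (x : ℕ)) ^ d = 1 := by rw [mul_pow, hτ, hw, one_mul]
  have hne : τ * omega d ^ (x : ℕ) ≠ omega d ^ (x : ℕ) := fun h =>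
    hτ1 (mul_right_cancel₀ (ne_zero_of_pow_eq_one (hw x)) (by rw [h, one_mul]))
  have hcor := correlations (loc_commute hAB (U A) (U B)) (loc_commute hAB (V A) (U B))
    (loc_commute hAB (V A) (V B)) (loc_mem_unitaryGroup A (hU A)) (loc_mem_unitaryGroup B (hU B))
    (by rw [← map_pow, hVd, map_one]) hτ hτ1 (hw x) hν hμ
    (by rw [← map_mul, h, map_smul, map_mul]) hΨ hΨ'
  simp only [← loc_eigProj] at hcor
  obtain ⟨⟨h00, h10⟩, ⟨h01, h11⟩, hUU⟩ := hcor
  -- The factor `μ⁻¹` attached to `U B` absorbs the eigenvalue of `U A ⊗ U B`; without it the two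
  -- levels of the qubit would differ by a relative phase.
  have hUU' : loc A (star (U A)) * (loc B (star (μ⁻¹ • U B)) *
      (loc A (eigProj d (τ * omega d ^ (x : ℕ)) (V A)) * Ψ)) =
      loc A (eigProj d (omega d ^ (x : ℕ)) (V A)) * Ψ := by
    have hμ' : star μ⁻¹ = μ := by
      have h1 := star_mul_self_of_pow_eq_one hμ
      rw [star_inv₀, inv_eq_of_mul_eq_one_right h1]
    rw [← hUU, star_smul, hμ', map_smul, Matrix.star_eq_conjTranspose, Matrix.star_eq_conjTranspose,
      ← loc_conjTranspose, ← loc_conjTranspose, Matrix.smul_mul, Matrix.mul_smul, Matrix.mul_assoc]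
    rfl
  obtain ⟨D, hD⟩ := readout_correlated hAB
    (eigProj_isStarProjection (hw x) (hVd A) (hV A)).isIdempotentElem
    (eigProj_isStarProjection hcτ (hVd A) (hV A)).isIdempotentElem
    (eigProj_mul_eigProj_eq_zero (hVd A) hcτ (hw x) hne)
    (eigProj_mul_eigProj_eq_zero (hVd A) (hw x) hcτ hne.symm) h00 h10 h01 h11 hUU'
    (((Real.sqrt (2 : ℕ))⁻¹ : ℝ) : ℂ) (((Real.sqrt d)⁻¹ : ℝ) : ℂ)
    ((Fintype.equivFin (Fin 2 × H A)).symm (t A)).1 ((Fintype.equivFin (Fin 2 × H B)).symm (t B)).1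
  have hT : ∀ (T₂ : Matrix (P → Fin 2) (∀ p, H p) ℂ) (T₁ M : Matrix (∀ p, H p) (∀ p, H p) ℂ),
      T₂ * (T₁ * M * T₁.conjTranspose) * T₂.conjTranspose =
        (T₂ * T₁) * M * (T₂ * T₁).conjTranspose := by
    intro T₂ T₁ M
    simp only [Matrix.conjTranspose_mul, Matrix.mul_assoc]
  rw [hT]
  refine isBell_of_mul_apply
    (D := D fun p => ((Fintype.equivFin (Fin 2 × H p)).symm (t p)).2) (fun r y => ?_) c
  have hD' := congrFun (congrFun (hD (r A) (r B))
    (fun p => ((Fintype.equivFin (Fin 2 × H p)).symm (t p)).2)) y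
  have hQ : ∀ Q : ∀ p, Matrix (H p) (H p) ℂ, loc A (Q A) * loc B (Q B) = tensorOp Q := fun Q =>
    (tensorOp_eq_loc_mul_loc hAB hall Q).symm
  have hQ' := hQ fun p =>
    readKraus A U V d μ ν τ (omega d ^ (x : ℕ)) p
      ((Fintype.equivFin (Fin 2 × H p)).symm (t p)).1 (r p) *
      (pairRound A hV hVd hτ hτ1 p).K (s p)
  have hA : readKraus A U V d μ ν τ (omega d ^ (x : ℕ)) A
      ((Fintype.equivFin (Fin 2 × H A)).symm (t A)).1 (r A) *
      (pairRound A hV hVd hτ hτ1 A).K (s A) =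
      qubitKraus (eigProj d (omega d ^ (x : ℕ)) (V A)) (eigProj d (τ * omega d ^ (x : ℕ)) (V A))
        (U A) ((Fintype.equivFin (Fin 2 × H A)).symm (t A)).1 (r A) *
        (((Real.sqrt (2 : ℕ))⁻¹ : ℝ) : ℂ) • (eigProj d (omega d ^ (x : ℕ)) (V A) +
          eigProj d (τ * omega d ^ (x : ℕ)) (V A)) := by
    rw [← hx]
    simp only [readKraus, partnerValue, pairRound, if_true, one_smul]
  have hB : readKraus A U V d μ ν τ (omega d ^ (x : ℕ)) B
      ((Fintype.equivFin (Fin 2 × H B)).symm (t B)).1 (r B) *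
      (pairRound A hV hVd hτ hτ1 B).K (s B) =
      qubitKraus (eigProj d (ν * (omega d ^ (x : ℕ))⁻¹) (V B))
        (eigProj d (ν * (τ * omega d ^ (x : ℕ))⁻¹) (V B))
        (μ⁻¹ • U B) ((Fintype.equivFin (Fin 2 × H B)).symm (t B)).1 (r B) *
        (((Real.sqrt d)⁻¹ : ℝ) : ℂ) • (1 : Matrix (H B) (H B) ℂ) := by
    simp only [readKraus, partnerValue, pairRound, if_neg hAB.symm]
  rw [← hA, ← hB, hQ'] at hD'
  rw [tensorOp_mul]
  subst hx
  calc _ = _ := rfl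
    _ = _ := hD'
    _ = _ := by split_ifs <;> rfl

end TwoRounds

/-! ### Unlocking -/

section Unlocking

variable {ι : Type} [Fintype ι] [DecidableEq ι] {d : ℕ}

/-- The partition that separates the qudit `i` from all others. -/
def splitOff (i : ι) (h : ({i}ᶜ : Finset ι).Nonempty) :
    Finpartition (Finset.univ : Finset ι) where
  parts := {{i}, {i}ᶜ}
  supIndep := by
    rw [Finset.supIndep_pair]
    · exact disjoint_compl_right
    · intro heq
      have : i ∈ ({i}ᶜ : Finset ι) := by
        rw [← heq]
        exact Finset.mem_singleton_self i
      simp at this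
  sup_parts := by simp
  bot_notMem := by
    simp only [Finset.bot_eq_empty, Finset.mem_insert, Finset.mem_singleton, not_or]
    exact ⟨(Finset.singleton_ne_empty i).symm, h.ne_empty.symm⟩

variable {π : Finpartition (Finset.univ : Finset ι)}

theorem prod_blocks (h : ι → ℂ) :
    ∏ T : {T // T ∈ π.parts}, ∏ i : {i // i ∈ T.1}, h i = ∏ i, h i := by
  have h1 : ∀ T : {T // T ∈ π.parts}, ∏ i : {i // i ∈ T.1}, h i = ∏ i ∈ T.1, h i :=
    fun T => Finset.prod_coe_sort T.1 h
  simp only [h1]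
  rw [Finset.prod_coe_sort π.parts fun T => ∏ i ∈ T, h i]
  have h2 := Finset.prod_biUnion (s := π.parts) (t := id) (f := h) π.disjoint
  rw [π.biUnion_parts] at h2
  exact h2.symm

/-- Configurations of the blocks holding a single copy, as configurations of the qudits. -/
def gatherOne : (∀ T : {T // T ∈ π.parts}, BlockSystem d 1 T) ≃ (ι → Fin d) :=
  (gather 1).trans (Equiv.funUnique (Fin 1) _)

theorem gatherOne_apply (x : ∀ T : {T // T ∈ π.parts}, BlockSystem d 1 T)
    (T : {T // T ∈ π.parts}) (i : {i // i ∈ T.1}) : gatherOne x i = x T 0 i := by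
  have := congrFun (congrFun (congrFun ((gather (d := d) (π := π) 1).left_inv x) T) 0) i
  exact this

theorem copies_one (ρ : Matrix (ι → Fin d) (ι → Fin d) ℂ) :
    copies ρ π 1 = ρ.submatrix gatherOne gatherOne := by
  ext x y
  rw [copies_apply, Fin.prod_univ_one]
  rfl

/-- The part of `g` on a block, acting on the system of the block. -/
def blockOp (g : PauliElt ι d) (T : {T // T ∈ π.parts}) :
    Matrix (BlockSystem d 1 T) (BlockSystem d 1 T) ℂ :=
  (g.restrict T.1).op.submatrix (Equiv.funUnique (Fin 1) _) (Equiv.funUnique (Fin 1) _)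

theorem tensorOp_blockOp (g : PauliElt ι d) :
    tensorOp (blockOp (π := π) g) = g.op.submatrix gatherOne gatherOne := by
  ext x y
  rw [Matrix.submatrix_apply, op_eq_tensorOp, tensorOp, tensorOp,
    ← prod_blocks (π := π) fun i => site g i (gatherOne x i) (gatherOne y i)]
  refine Finset.prod_congr rfl fun T _ => ?_
  simp only [gatherOne_apply]
  rfl

theorem tensorOp_blockOp_mul {g : PauliElt ι d} {P : Matrix (ι → Fin d) (ι → Fin d) ℂ} {a : ℂ}
    (h : g.op * P = a • P) :
    (tensorOp (blockOp (π := π) g) : Matrix (∀ T : {T // T ∈ π.parts}, BlockSystem d 1 T)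
      (∀ T : {T // T ∈ π.parts}, BlockSystem d 1 T) ℂ) * P.submatrix (gatherOne (π := π)) id =
      a • P.submatrix (gatherOne (π := π)) id := by
  have h1 := Matrix.submatrix_mul_equiv g.op P (gatherOne (π := π)) (gatherOne (π := π)) id
  rw [tensorOp_blockOp, h1, h]
  rfl

theorem blockOp_mul (g h : PauliElt ι d) (T : {T // T ∈ π.parts}) :
    blockOp g T * blockOp h T = ((g.restrict T.1).op * (h.restrict T.1).op).submatrix
      (Equiv.funUnique (Fin 1) _) (Equiv.funUnique (Fin 1) _) :=
  Matrix.submatrix_mul_equiv _ _ _ _ _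

theorem blockOp_mul_blockOp [NeZero d] (g h : PauliElt ι d) (T : {T // T ∈ π.parts}) :
    blockOp g T * blockOp h T = (∏ i ∈ T.1, phase g h i) • (blockOp h T * blockOp g T) := by
  rw [blockOp_mul, blockOp_mul, op_mul_op, ← Finset.prod_coe_sort T.1 (phase g h)]
  rfl

theorem submatrix_mem_unitaryGroup {α β : Type} [Fintype α] [DecidableEq α] [Fintype β]
    [DecidableEq β] (e : α ≃ β) {M : Matrix β β ℂ} (hM : M ∈ Matrix.unitaryGroup β ℂ) :
    M.submatrix e e ∈ Matrix.unitaryGroup α ℂ := by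
  rw [Matrix.mem_unitaryGroup_iff', Matrix.star_eq_conjTranspose, Matrix.conjTranspose_submatrix,
    Matrix.submatrix_mul_equiv, ← Matrix.star_eq_conjTranspose, Matrix.mem_unitaryGroup_iff'.1 hM,
    Matrix.submatrix_one_equiv]

theorem submatrix_pow_eq_one {α β : Type} [Fintype α] [DecidableEq α] [Fintype β]
    [DecidableEq β] (e : α ≃ β) {M : Matrix β β ℂ} {m : ℕ} (hM : M ^ m = 1) :
    M.submatrix e e ^ m = 1 := by
  have h : ∀ m, M.submatrix e e ^ m = (M ^ m).submatrix e e := by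
    intro m
    induction m with
    | zero => simp
    | succ m ih => rw [pow_succ, ih, Matrix.submatrix_mul_equiv, pow_succ]
  rw [h, hM, Matrix.submatrix_one_equiv]

theorem phase_pow [NeZero d] (g h : PauliElt ι d) (i : ι) : phase g h i ^ d = 1 := by
  rw [phase, div_pow, omega_pow_pow_dim, omega_pow_pow_dim, div_one]

/-- Splitting off `i` isolates its phase: the block `{i}` sees only `phase g h i`, which serves as
the `τ` of the protocol, and the remaining qudits jointly act as the second party. -/
theorem exists_distillable [NeZero d] {g h : PauliElt ι d} {i j : ι} (hij : i ≠ j)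
    (hgh : phase g h i ≠ 1) {ρ P : Matrix (ι → Fin d) (ι → Fin d) ℂ} {c μ ν : ℂ}
    (hP : IsStarProjection P) (hρ : ρ = c • P) (htr : ρ.trace = 1) (hμ : μ ^ d = 1)
    (hν : ν ^ d = 1) (hg : g.op * P = ν • P) (hh : h.op * P = μ • P) :
    ∃ (π : Finpartition (Finset.univ : Finset ι)) (A B : {T // T ∈ π.parts}),
      A ≠ B ∧ Distillable ρ π A B := by
  have hne : ({i}ᶜ : Finset ι).Nonempty := ⟨j, by simpa using hij.symm⟩
  set π := splitOff i hne
  have hmem : ∀ T, T ∈ π.parts ↔ T = {i} ∨ T = {i}ᶜ := fun T => by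
    change T ∈ ({{i}, {i}ᶜ} : Finset (Finset ι)) ↔ _
    rw [Finset.mem_insert, Finset.mem_singleton]
  let A : {T // T ∈ π.parts} := ⟨{i}, (hmem _).2 (Or.inl rfl)⟩
  let B : {T // T ∈ π.parts} := ⟨{i}ᶜ, (hmem _).2 (Or.inr rfl)⟩
  have hAB : A ≠ B := by
    intro heq
    have h1 : ({i} : Finset ι) = {i}ᶜ := congrArg Subtype.val heq
    have h2 : i ∈ ({i}ᶜ : Finset ι) := h1 ▸ Finset.mem_singleton_self i
    simp at h2
  have hall : ∀ T : {T // T ∈ π.parts}, T = A ∨ T = B := fun T =>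
    ((hmem T.1).1 T.2).imp (fun h => Subtype.ext h) fun h => Subtype.ext h
  set Ψ : Matrix (∀ T : {T // T ∈ π.parts}, BlockSystem d 1 T) (ι → Fin d) ℂ :=
    P.submatrix gatherOne id with hΨdef
  -- As `P = P * Pᴴ`, the columns of the projector play the role of shared eigenvectors, so the
  -- mixed state is treated like a pure one.
  have hcopies : copies ρ π 1 = c • (Ψ * Ψ.conjTranspose) := by
    rw [copies_one, hρ, hΨdef, Matrix.conjTranspose_submatrix,
      ← Matrix.submatrix_mul _ _ _ _ _ Function.bijective_id, ← Matrix.star_eq_conjTranspose,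
      hP.isSelfAdjoint.star_eq, hP.isIdempotentElem.eq]
    rfl
  have hA : ∏ l ∈ A.1, phase g h l = phase g h i := Finset.prod_singleton _ _
  obtain ⟨Λ, hΛ⟩ := exists_bell_protocol (d := d) (U := blockOp h) (V := blockOp g) hAB hall
    (fun T => submatrix_mem_unitaryGroup _ (op_mem_unitaryGroup _))
    (fun T => submatrix_mem_unitaryGroup _ (op_mem_unitaryGroup _))
    (fun T => submatrix_pow_eq_one _ (op_pow_dim _)) (phase_pow g h i) hgh hμ hν
    (by rw [blockOp_mul_blockOp, hA]) (tensorOp_blockOp_mul hh)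
    (tensorOp_blockOp_mul hg)
  -- One copy suffices for every `ε`, because the fidelity is exactly 1.
  refine ⟨π, A, B, hAB, fun ε hε => ⟨1, Λ, ?_⟩⟩
  rw [(hcopies ▸ hΛ c : IsBell A B (Λ.run (copies ρ π 1))).bellFidelity_eq_one hAB hall]
  · linarith
  · rw [Λ.trace_run, trace_copies, htr, one_pow]

end Unlocking

end UnlockableBE

end

/-! ### Assembly of the main theorem. -/

theorem theorem2 (n d k b : ℕ) (hd : 2 ≤ d)
    (g : Fin k → UnlockableBE.PauliElt (Fin n) d)
    (hcomm : ∀ j l, Commute (g j).op (g l).op)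
    (h1 : ∀ i j : Fin n, i ≠ j →
      ∃ π : Finpartition (Finset.univ : Finset (Fin n)),
        UnlockableBE.IsProperPartition π ∧
        (∃ Q₁ ∈ π.parts, ∃ Q₂ ∈ π.parts, Q₁ ≠ Q₂ ∧ i ∈ Q₁ ∧ j ∈ Q₂) ∧
        UnlockableBE.StabSeparable g π)
    (h2 : ∃ π : Finpartition (Finset.univ : Finset (Fin n)),
        UnlockableBE.IsProperPartition π ∧
        UnlockableBE.StabSeparable g π ∧
        ∃ T₁ ∈ π.parts, 1 < T₁.card ∧
          UnlockableBE.StabInseparable (fun j => (g j).restrict T₁) ∧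
          UnlockableBE.StabComplete (fun j => (g j).restrict T₁))
    (hb : Module.finrank ℂ (UnlockableBE.stabilizedSubspace g) = b)
    (hb0 : 0 < b) :
    b ∣ d ^ n ∧
    (UnlockableBE.jointEigenspaces g).Finite ∧
    (UnlockableBE.jointEigenspaces g).ncard = d ^ n / b ∧
    (∀ E ∈ UnlockableBE.jointEigenspaces g, ∀ F ∈ UnlockableBE.jointEigenspaces g,
      E ≠ F → E ⟂ F) ∧
    sSup (UnlockableBE.jointEigenspaces g) = ⊤ ∧
    (∀ E ∈ UnlockableBE.jointEigenspaces g, Module.finrank ℂ E = b) ∧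
    (∀ E ∈ UnlockableBE.jointEigenspaces g,
      UnlockableBE.IsUnlockableBoundEntangled (UnlockableBE.maxMixed E)) := by
  open UnlockableBE in
  have : NeZero d := ⟨by omega⟩
  have hstab : jointEigenspace g (fun _ => 1) ≠ ⊥ := by
    intro h
    rw [stabilizedSubspace, h, finrank_bot] at hb
    omega
  have hdim : ∀ E ∈ jointEigenspaces g, Module.finrank ℂ E = b := by
    rintro _ ⟨hE, μ, rfl⟩
    rw [finrank_eq_of_ne_bot hE hstab]
    exact hb
  have hortho : ∀ E ∈ jointEigenspaces g, ∀ F ∈ jointEigenspaces g, E ≠ F → E ⟂ F :=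
    fun E hE F hF => jointEigenspaces_isOrtho hE hF
  have htop := sSup_jointEigenspaces hstab
  obtain ⟨hfin, hcard⟩ := finite_and_ncard_mul_of_isOrtho (fun E hE => hE.1) hdim hortho htop
  have hdn : Module.finrank ℂ (EuclideanSpace ℂ (Fin n → Fin d)) = d ^ n := by simp
  rw [hdn] at hcard
  refine ⟨⟨_, by rw [← hcard, mul_comm]⟩, hfin, ?_, hortho, htop, hdim, ?_⟩
  · rw [← hcard, Nat.mul_div_cancel _ hb0]
  rintro _ ⟨hE, μ, rfl⟩
  obtain ⟨hμ, hadj, hproj, heig, hP0⟩ := projMatrix_spec hcomm hE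
  obtain ⟨htr, hdens⟩ := maxMixed_isDensity hproj hP0
  obtain ⟨π, -, -, T, -, hT, hins, -⟩ := h2
  obtain ⟨i, hi, j, l, hphase⟩ := exists_phase_ne_one hT hins
  -- A second qudit of `T` makes the complement of `i` nonempty, so that `i` can be split off.
  obtain ⟨i', hi', hne⟩ := Finset.exists_mem_ne hT i
  have heig' : ∀ j, (g j).op * maxMixed (jointEigenspace g μ) =
      μ j • maxMixed (jointEigenspace g μ) := by
    intro j
    rw [maxMixed, Matrix.mul_smul, heig, smul_comm]
  refine ⟨⟨hdens, not_separableState hphase (ne_zero_of_pow_eq_one (hμ j))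
    (ne_zero_of_pow_eq_one (hμ l)) (heig' j) (heig' l), ?_⟩, ?_⟩
  · intro A B hAB
    obtain ⟨p, rfl⟩ := exists_eq_blockOf_bot A
    obtain ⟨q, rfl⟩ := exists_eq_blockOf_bot B
    obtain ⟨π', -, ⟨Q₁, hQ₁, Q₂, hQ₂, hQ, hp, hq⟩, hsep⟩ := h1 p q fun h => hAB (by rw [h])
    -- Transpose on the block `Q₁` of `p`: local commutation there is the phase condition, and `q`
    -- lies outside it.
    have hS : ∀ j l, ∏ i with i ∈ Q₁, phase (g j) (g l) i = 1 := by
      intro j l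
      rw [Finset.filter_univ_mem, ← commute_restrict_iff]
      exact hsep Q₁ hQ₁ j l
    refine not_distillable_of_posSemidef hdens.2 (fun i => i ∈ Q₁) hp
      (fun h => Finset.disjoint_left.1 (π'.disjoint hQ₁ hQ₂ hQ) h hq) ?_
    exact (partialTranspose_posSemidef _ hS hadj hproj).smul (inv_nonneg.2 htr.le)
  · exact exists_distillable hne.symm hphase hproj rfl hdens.2 (hμ l) (hμ j) (heig j) (heig l)
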